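/- Let $S$ be an inverse semigroup with semilattice of idempotents $E(S)$ and natural partial order $s\le t \iff s=te$ for some $e\in E(S)$; put $\mathbf d(s)=s^{-1}s$, $\mathbf r(s)=ss^{-1}$. Loganathan's category $L(S)$ has object set $E(S)$; its arrows $e\to f$ are the pairs $(f,s)$ with $s\in S$, $\mathbf d(s)=e$, $\mathbf r(s)\le f$, and $(g,t)(f,s)=(g,ts)$. The classifying topos $\mathcal B(S)$ is the category of presheaves of sets on $L(S)$. An *$S$-set* is a set $X$ with a homomorphism from $S$ to the inverse semigroup of partial bijections of $X$ such that every $x\in X$ lies in the domain of some $s\in S$; a morphism $X\to Y$ is a map $\varphi$ such that whenever $s\cdot x$ is defined, $s\cdot \varphi(x)$ is defined and equals $\varphi(s\cdot x)$. An $S$-set $X$ is *transitive* if $X\neq\varnothing$ and for all $x,y\in X$ there is $s$ with $s\cdot x=y$; it is an *$S$-torsor* if it is transitive and, whenever $s\cdot x=t\cdot x$ (both defined), there is $c\le s,t$ with $c\cdot x=s\cdot x$. It is *universal* if it is isomorphic, for some nonempty filter $F$ in $E(S)$ with upward closure $H=F^{\uparrow}$ in $S$, to the $S$-set of cosets $(xH)^{\uparrow}$,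 $\mathbf d(x)\in H$, where $s\cdot (xH)^{\uparrow}=(sxH)^{\uparrow}$ is defined iff $(sxH)^{\uparrow}$ is a coset. A functor $A\colon L(S)\to\mathsf{Sets}$ is *directed* if its category of elements is nonempty and any two objects $i,j$ of it admit a diagram $i\leftarrow k\to j$; it is *filtered* if moreover for any parallel arrows $i\rightrightarrows j$ in the category of elements there is an arrow $k\to i$ having equal composites with them. For an $S$-set $X$ let $\Phi(X)\colon L(S)\to\mathsf{Sets}$ be the functor sending $e$ to $\{x\in X: e\cdot x \text{ is defined}\}$ and $(f,s)$ to $x\mapsto s\cdot x$, and for a morphism $\varphi$ of $S$-sets let $\Phi(\varphi)$ be given by the restrictions of $\varphi$. For a functor $F\colon L(S)\to \mathsf{Sets}$ let $\Psi(F)$ be the quotient of $\bigsqcup_{e\in E(S)}F(e)$ by the equivalence relation generated by $(e,x)\sim(e',F(e',e)(x))$, $e\le e'$, where $s\circ\alpha$ is defined iff $\alpha=[\mathbf d(s),x]$ for some $x\in F(\mathbf d(s))$, and then $s\circ[\mathbf d(s),x]=[\mathbf r(s),F(\mathbf r(s),s)(x)]$; for a natural transformation $a$ let $\Psi(a)$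 be $[e,x]\mapsto[e,a_e(x)]$. **Proposition.** $\Phi$ and $\Psi$ give (up to natural isomorphism) mutually quasi-inverse equivalences between the category of transitive $S$-sets and the category of directed pullback-preserving functors $L(S)\to\mathsf{Sets}$ (with natural transformations as morphisms). Universal $S$-sets are transitive, filtered functors are directed and preserve pullbacks, and this equivalence restricts to an equivalence between the category of universal $S$-sets and the category of filtered functors $L(S)\to\mathsf{Sets}$: a transitive $S$-set $X$ is universal iff the corresponding functor is filtered, and a directed pullback-preserving functor is filtered iff the corresponding $S$-set is universal. The universal $S$-sets are exactly the $S$-torsors. Consequently, the category of points of $\mathcal B(S)$ (geometric morphisms $\mathsf{Sets}\to\mathcal B(S)$, that is, adjoint pairs $f^*\dashv f_*$ with $f^*$ preserving finite limits, with the natural transformations between the inverse image functors as morphisms) is equivalent to the category of universal $S$-sets. -/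

import Mathlib

open CategoryTheory CategoryTheory.Limits

universe u v₁ v₂ u₁ u₂

/-! ### Inverse semigroups -/

/-- An inverse semigroup: every element `a` has exactly one inverse `a⁻¹`. -/
class InverseSemigroup (S : Type u) extends Semigroup S, Inv S where
  mul_inv_mul : ∀ a : S, a * a⁻¹ * a = a
  inv_mul_inv : ∀ a : S, a⁻¹ * a * a⁻¹ = a⁻¹
  inv_unique : ∀ a b : S, a * b * a = a → b * a * b = b → b = a⁻¹

namespace InverseSemigroup

variable {S : Type u} [InverseSemigroup S]

/-- `d(s) = s⁻¹ s`. -/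
def dom (s : S) : S := s⁻¹ * s

/-- `r(s) = s s⁻¹`. -/
def ran (s : S) : S := s * s⁻¹

/-- The natural partial order: `s ≤ t` iff `s = t e` for some idempotent `e`. -/
def NatLE (s t : S) : Prop := ∃ e : S, IsIdempotentElem e ∧ s = t * e

/-- The upward closure of a subset. -/
def upClosure (A : Set S) : Set S := {s | ∃ a ∈ A, NatLE a s}

theorem inv_inv' (a : S) : a⁻¹⁻¹ = a :=
  (inv_unique a⁻¹ a (inv_mul_inv a) (mul_inv_mul a)).symm

theorem inv_idem {e : S} (he : IsIdempotentElem e) : e⁻¹ = e :=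
  (inv_unique e e (by rw [he.eq, he.eq]) (by rw [he.eq, he.eq])).symm

theorem dom_idem (a : S) : IsIdempotentElem (dom a) := by
  unfold dom IsIdempotentElem
  rw [← mul_assoc, inv_mul_inv]

theorem ran_idem (a : S) : IsIdempotentElem (ran a) := by
  unfold ran IsIdempotentElem
  rw [← mul_assoc, mul_inv_mul]

theorem mul_dom (a : S) : a * dom a = a := by
  unfold dom; rw [← mul_assoc, mul_inv_mul]

theorem ran_mul (a : S) : ran a * a = a := mul_inv_mul a

theorem idem_mul {e f : S} (he : IsIdempotentElem e) (hf : IsIdempotentElem f) :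
    IsIdempotentElem (e * f) := by
  have he' := he.eq
  have hf' := hf.eq
  have h1 : e * f * (f * (e * f)⁻¹ * e) * (e * f) = e * f := by
    calc e * f * (f * (e * f)⁻¹ * e) * (e * f)
        = e * (f * f) * (e * f)⁻¹ * ((e * e) * f) := by simp only [mul_assoc]
      _ = e * f := by rw [he', hf', mul_inv_mul]
  have h2 : f * (e * f)⁻¹ * e * (e * f) * (f * (e * f)⁻¹ * e) = f * (e * f)⁻¹ * e := by
    calc f * (e * f)⁻¹ * e * (e * f) * (f * (e * f)⁻¹ * e)
        = f * ((e * f)⁻¹ * ((e * e) * (f * f)) * (e * f)⁻¹) * e := by simp only [mul_assoc]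
      _ = f * (e * f)⁻¹ * e := by rw [he', hf', inv_mul_inv]
  have h3 := inv_unique _ _ h1 h2
  have h4 : IsIdempotentElem (e * f)⁻¹ := by
    show (e * f)⁻¹ * (e * f)⁻¹ = (e * f)⁻¹
    calc (e * f)⁻¹ * (e * f)⁻¹
        = (f * (e * f)⁻¹ * e) * (f * (e * f)⁻¹ * e) := by rw [h3]
      _ = f * ((e * f)⁻¹ * (e * f) * (e * f)⁻¹) * e := by simp only [mul_assoc]
      _ = (e * f)⁻¹ := by rw [inv_mul_inv, h3]
  have h5 := inv_idem h4
  rw [inv_inv'] at h5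
  rw [h5]; exact h4

theorem idem_comm {e f : S} (he : IsIdempotentElem e) (hf : IsIdempotentElem f) :
    e * f = f * e := by
  have he' := he.eq
  have hf' := hf.eq
  have h1 := (idem_mul he hf).eq
  have h2 := (idem_mul hf he).eq
  have h : f * e = (e * f)⁻¹ := by
    apply inv_unique
    · calc e * f * (f * e) * (e * f) = e * (f * f) * ((e * e) * f) := by simp only [mul_assoc]
        _ = e * f := by rw [he', hf', h1]
    · calc f * e * (e * f) * (f * e) = f * (e * e) * ((f * f) * e) := by simp only [mul_assoc]
        _ = f * e := by rw [he', hf', h2]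
  rw [h, inv_idem (idem_mul he hf)]

theorem mul_inv_rev' (a b : S) : (a * b)⁻¹ = b⁻¹ * a⁻¹ := by
  have hc := idem_comm (dom_idem a) (ran_idem b)
  unfold dom ran at hc
  symm
  apply inv_unique
  · calc a * b * (b⁻¹ * a⁻¹) * (a * b) = a * ((b * b⁻¹) * (a⁻¹ * a)) * b := by
          simp only [mul_assoc]
      _ = (a * a⁻¹ * a) * (b * b⁻¹ * b) := by rw [← hc]; simp only [mul_assoc]
      _ = a * b := by rw [mul_inv_mul, mul_inv_mul]
  · calc b⁻¹ * a⁻¹ * (a * b) * (b⁻¹ * a⁻¹) = b⁻¹ * ((a⁻¹ * a) * (b * b⁻¹)) * a⁻¹ := by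
          simp only [mul_assoc]
      _ = (b⁻¹ * b * b⁻¹) * (a⁻¹ * a * a⁻¹) := by rw [hc]; simp only [mul_assoc]
      _ = b⁻¹ * a⁻¹ := by rw [inv_mul_inv, inv_mul_inv]

/-- An idempotent can be moved from left to right: `e s = s (s⁻¹ e s)`. -/
theorem idem_mul_eq {e : S} (he : IsIdempotentElem e) (s : S) :
    e * s = s * (s⁻¹ * e * s) := by
  calc e * s = e * ran s * s := by rw [mul_assoc, ran_mul]
    _ = s * (s⁻¹ * e * s) := by
      rw [idem_comm he (ran_idem s)]; unfold ran; simp only [mul_assoc]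

theorem conj_idem {e : S} (he : IsIdempotentElem e) (s : S) :
    IsIdempotentElem (s⁻¹ * e * s) := by
  show s⁻¹ * e * s * (s⁻¹ * e * s) = s⁻¹ * e * s
  calc s⁻¹ * e * s * (s⁻¹ * e * s) = s⁻¹ * e * (s * (s⁻¹ * e * s)) := by simp only [mul_assoc]
    _ = s⁻¹ * (e * e) * s := by rw [← idem_mul_eq he]; simp only [mul_assoc]
    _ = s⁻¹ * e * s := by rw [he.eq]

theorem NatLE.refl (s : S) : NatLE s s := ⟨dom s, dom_idem s, (mul_dom s).symm⟩

theorem NatLE.trans {s t w : S} (h : NatLE s t) (h' : NatLE t w) : NatLE s w := by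
  obtain ⟨e, he, rfl⟩ := h
  obtain ⟨f, hf, rfl⟩ := h'
  exact ⟨f * e, idem_mul hf he, mul_assoc _ _ _⟩

theorem NatLE.mul {s t s' t' : S} (h : NatLE s t) (h' : NatLE s' t') :
    NatLE (s * s') (t * t') := by
  obtain ⟨e, he, rfl⟩ := h
  obtain ⟨f, hf, rfl⟩ := h'
  refine ⟨(t'⁻¹ * e * t') * f, idem_mul (conj_idem he t') hf, ?_⟩
  calc t * e * (t' * f) = t * (e * t') * f := by simp only [mul_assoc]
    _ = t * t' * (t'⁻¹ * e * t' * f) := by rw [idem_mul_eq he]; simp only [mul_assoc]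

theorem NatLE.inv {s t : S} (h : NatLE s t) : NatLE s⁻¹ t⁻¹ := by
  obtain ⟨e, he, rfl⟩ := h
  rw [mul_inv_rev', inv_idem he]
  exact ⟨t⁻¹⁻¹ * e * t⁻¹, conj_idem he _, idem_mul_eq he _⟩

theorem NatLE.mul_of_ran_le {s f : S} (hf : IsIdempotentElem f) (h : NatLE (ran s) f) :
    f * s = s := by
  obtain ⟨e, -, h⟩ := h
  calc f * s = f * (ran s * s) := by rw [ran_mul]
    _ = (f * f) * e * s := by rw [h]; simp only [mul_assoc]
    _ = s := by rw [hf.eq, ← h, ran_mul]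

theorem ran_le_of_mul {s f : S} (h : f * s = s) :
    NatLE (ran s) f := by
  refine ⟨ran s, ran_idem s, ?_⟩
  unfold ran
  rw [← mul_assoc, h]

end InverseSemigroup

open InverseSemigroup

/-! ### Loganathan's category -/

/-- Objects of Loganathan's category `L(S)`: the idempotents of `S`. -/
structure Loganathan (S : Type u) [InverseSemigroup S] : Type u where
  elt : S
  idem : IsIdempotentElem elt

namespace Loganathan

variable {S : Type u} [InverseSemigroup S]

/-- An arrow `e ⟶ f` of `L(S)` is an element `s` with `d(s) = e` and `r(s) ≤ f`
(that is, the pair `(f, s)`). -/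
@[ext]
structure Hom (e f : Loganathan S) : Type u where
  elt : S
  dom_eq : dom elt = e.elt
  ran_le : NatLE (ran elt) f.elt

/-- Composition is multiplication in `S`: `(g, t)(f, s) = (g, ts)`. -/
instance : SmallCategory (Loganathan S) where
  Hom e f := Hom e f
  id e := ⟨e.elt, by rw [dom, inv_idem e.idem, e.idem.eq],
    by rw [ran, inv_idem e.idem, e.idem.eq]; exact NatLE.refl _⟩
  comp {e f g} s t := ⟨t.elt * s.elt, by
      have h := NatLE.mul_of_ran_le f.idem s.ran_le
      rw [← t.dom_eq, dom] at h
      rw [← s.dom_eq, dom, dom, mul_inv_rev', mul_assoc, ← mul_assoc t.elt⁻¹, h], by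
      apply ran_le_of_mul
      rw [← mul_assoc, NatLE.mul_of_ran_le g.idem t.ran_le]⟩
  id_comp {e f} s := by
    apply Hom.ext
    show s.elt * e.elt = s.elt
    rw [← s.dom_eq, mul_dom]
  comp_id {e f} s := by
    apply Hom.ext
    exact NatLE.mul_of_ran_le f.idem s.ran_le
  assoc f g h := by
    apply Hom.ext
    exact (mul_assoc _ _ _).symm

/-- `d(s)` as an object of `L(S)`. -/
def domObj (s : S) : Loganathan S := ⟨dom s, dom_idem s⟩

/-- `r(s)` as an object of `L(S)`. -/
def ranObj (s : S) : Loganathan S := ⟨ran s, ran_idem s⟩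

/-- The arrow `(r(s), s) : d(s) ⟶ r(s)`. -/
def arrow (s : S) : domObj s ⟶ ranObj s := (⟨s, rfl, NatLE.refl _⟩ : Hom _ _)

/-- The arrow `(e', e) : e ⟶ e'` for idempotents `e ≤ e'`. -/
def incl {e e' : Loganathan S} (h : NatLE e.elt e'.elt) : e ⟶ e' :=
  (⟨e.elt, by rw [dom, inv_idem e.idem, e.idem.eq],
    by rw [ran, inv_idem e.idem, e.idem.eq]; exact h⟩ : Hom e e')

end Loganathan

/-! ### Sets with an action of an inverse semigroup -/

/-- An (effective, left) `S`-set: a set `X` with a homomorphism from `S` to the symmetric inverse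
semigroup of partial bijections of `X`, such that every point lies in the domain of some `s`.
`y ∈ act s x` means that `s · x` is defined and equal to `y`. -/
structure LeftSet (S : Type u) [InverseSemigroup S] : Type (u + 1) where
  carrier : Type u
  act : S → (carrier ≃. carrier)
  act_mul : ∀ s t : S, act (s * t) = (act t).trans (act s)
  effective : ∀ x : carrier, ∃ s : S, ∃ y : carrier, y ∈ act s x

namespace LeftSet

variable {S : Type u} [InverseSemigroup S]

/-- A morphism of `S`-sets: a map `f` such that if `s · x` is defined, then so is `s · f x`, and
`f (s · x) = s · f x`. -/
@[ext]
structure Hom (X Y : LeftSet S) : Type u where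
  toFun : X.carrier → Y.carrier
  map_act : ∀ (s : S) (x y : X.carrier), y ∈ X.act s x → toFun y ∈ Y.act s (toFun x)

/-- The category of `S`-sets. -/
instance : Category.{u} (LeftSet S) where
  Hom X Y := Hom X Y
  id X := ⟨id, fun _ _ _ h => h⟩
  comp f g := ⟨g.toFun ∘ f.toFun, fun s x y h => g.map_act s _ _ (f.map_act s x y h)⟩

theorem mem_act_mul (X : LeftSet S) (s t : S) (x z : X.carrier) :
    z ∈ X.act (s * t) x ↔ ∃ y, y ∈ X.act t x ∧ z ∈ X.act s y := by
  rw [X.act_mul]; exact PEquiv.mem_trans _ _ _ _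

theorem mem_act_idem (X : LeftSet S) {e : S} (he : IsIdempotentElem e) {x y : X.carrier}
    (h : y ∈ X.act e x) : y = x := by
  have h' := h
  rw [← he.eq, mem_act_mul] at h'
  obtain ⟨z, hz, hz'⟩ := h'
  obtain rfl : y = z := Option.mem_unique h hz
  exact (X.act e).inj hz' h

/-- Nonempty and transitive `S`-sets. -/
def isTransitive (S : Type u) [InverseSemigroup S] : ObjectProperty (LeftSet S) := fun X =>
  Nonempty X.carrier ∧ ∀ x y : X.carrier, ∃ s : S, y ∈ X.act s x

/-- Free `S`-sets: if `s · x = t · x`, both defined, then `c · x = s · x` for some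
`c ≤ s, t`. -/
def isFree (S : Type u) [InverseSemigroup S] : ObjectProperty (LeftSet S) := fun X =>
  ∀ (s t : S) (x y : X.carrier), y ∈ X.act s x → y ∈ X.act t x →
    ∃ c : S, NatLE c s ∧ NatLE c t ∧ y ∈ X.act c x

/-- `S`-torsors: (nonempty) transitive and free `S`-sets. -/
def isTorsor (S : Type u) [InverseSemigroup S] : ObjectProperty (LeftSet S) := fun X =>
  isTransitive S X ∧ isFree S X

end LeftSet

/-! ### Representations on cosets and universal `S`-sets -/

/-- A closed inverse subsemigroup (nonempty and upward closed). -/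
structure ClosedInverseSubsemigroup (S : Type u) [InverseSemigroup S] where
  carrier : Set S
  nonempty : carrier.Nonempty
  mul_mem : ∀ {a b : S}, a ∈ carrier → b ∈ carrier → a * b ∈ carrier
  inv_mem : ∀ {a : S}, a ∈ carrier → a⁻¹ ∈ carrier
  closed : upClosure carrier = carrier

/-- A filter in the semilattice of idempotents `E(S)`. -/
structure IdempotentFilter (S : Type u) [InverseSemigroup S] where
  carrier : Set S
  idem : ∀ {e : S}, e ∈ carrier → IsIdempotentElem e
  nonempty : carrier.Nonempty
  mul_mem : ∀ {e f : S}, e ∈ carrier → f ∈ carrier → e * f ∈ carrier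
  up_mem : ∀ {e f : S}, e ∈ carrier → IsIdempotentElem f → NatLE e f → f ∈ carrier

/-- The closed inverse subsemigroup `F↑` of a filter `F` in `E(S)`. -/
def IdempotentFilter.up {S : Type u} [InverseSemigroup S] (F : IdempotentFilter S) :
    ClosedInverseSubsemigroup S where
  carrier := upClosure F.carrier
  nonempty := by
    obtain ⟨e, he⟩ := F.nonempty
    exact ⟨e, e, he, NatLE.refl e⟩
  mul_mem := by
    rintro a b ⟨e, he, hea⟩ ⟨f, hf, hfb⟩
    exact ⟨e * f, F.mul_mem he hf, hea.mul hfb⟩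
  inv_mem := by
    rintro a ⟨e, he, hea⟩
    refine ⟨e, he, ?_⟩
    have := hea.inv
    rwa [inv_idem (F.idem he)] at this
  closed := by
    ext s
    constructor
    · rintro ⟨a, ⟨e, he, hea⟩, has⟩
      exact ⟨e, he, hea.trans has⟩
    · intro hs
      exact ⟨s, hs, NatLE.refl s⟩

/-- The partial bijection whose graph is a given functional and injective relation. -/
noncomputable def PEquiv.ofGraph {A : Type u} (r : A → A → Prop)
    (hf : ∀ a b b', r a b → r a b' → b = b') (hi : ∀ a a' b, r a b → r a' b → a = a') :
    A ≃. A := by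
  classical
  exact
  { toFun := fun a => if h : ∃ b, r a b then some h.choose else none
    invFun := fun b => if h : ∃ a, r a b then some h.choose else none
    inv := by
      intro a b
      constructor
      · intro h
        by_cases hb : ∃ a, r a b
        · simp only [hb, dite_true] at h
          obtain rfl := Option.some.inj h
          have ha : ∃ b', r hb.choose b' := ⟨b, hb.choose_spec⟩
          simp only [ha, dite_true]
          exact congrArg some (hf _ _ _ ha.choose_spec hb.choose_spec)
        · simp [hb] at h
      · intro h
        by_cases ha : ∃ b, r a b
        · simp only [ha, dite_true] at h
          obtain rfl := Option.some.inj h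
          have hb : ∃ a', r a' ha.choose := ⟨a, ha.choose_spec⟩
          simp only [hb, dite_true]
          exact congrArg some (hi _ _ _ hb.choose_spec ha.choose_spec)
        · simp [ha] at h }

theorem PEquiv.mem_ofGraph {A : Type u} (r : A → A → Prop)
    (hf : ∀ a b b', r a b → r a b' → b = b') (hi : ∀ a a' b, r a b → r a' b → a = a') (a b : A) :
    b ∈ PEquiv.ofGraph r hf hi a ↔ r a b := by
  classical
  show b ∈ (if h : ∃ b, r a b then some h.choose else none) ↔ r a b
  by_cases ha : ∃ b, r a b
  · simp only [ha, dite_true, Option.mem_some_iff]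
    constructor
    · rintro rfl
      exact ha.choose_spec
    · intro h
      exact hf _ _ _ ha.choose_spec h
  · simp only [ha, dite_false]
    constructor
    · intro h; simp at h
    · intro h; exact absurd ⟨b, h⟩ ha

namespace ClosedInverseSubsemigroup

variable {S : Type u} [InverseSemigroup S] (H : ClosedInverseSubsemigroup S)

/-- The set `(xH)↑`. -/
def cosetOf (x : S) : Set S := upClosure ((fun h => x * h) '' H.carrier)

/-- The set `X_H` of cosets with respect to `H`: the sets `(xH)↑` with `d(x) ∈ H`. -/
def Coset : Type u := {A : Set S // ∃ x : S, dom x ∈ H.carrier ∧ A = H.cosetOf x}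

/-- The graph of the action of `s` on cosets: `s · (xH)↑ = (sxH)↑`, defined if and only if
`(sxH)↑` is a coset. -/
def cosetRel (s : S) (A B : H.Coset) : Prop :=
  ∃ x : S, dom x ∈ H.carrier ∧ A.1 = H.cosetOf x ∧ B.1 = H.cosetOf (s * x)

theorem up_mem {a b : S} (ha : a ∈ H.carrier) (h : NatLE a b) : b ∈ H.carrier := by
  rw [← H.closed]; exact ⟨a, ha, h⟩

theorem mul_mem_cosetOf (x : S) {h : S} (hh : h ∈ H.carrier) : x * h ∈ H.cosetOf x :=
  ⟨x * h, ⟨h, hh, rfl⟩, NatLE.refl _⟩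

theorem cosetOf_mul_subset {x y : S} (h : H.cosetOf x ⊆ H.cosetOf y) (s : S) :
    H.cosetOf (s * x) ⊆ H.cosetOf (s * y) := by
  rintro t ⟨_, ⟨k, hk, rfl⟩, hkt⟩
  obtain ⟨_, ⟨l, hl, rfl⟩, hlk⟩ := h (H.mul_mem_cosetOf x hk)
  refine ⟨s * y * l, ⟨l, hl, rfl⟩, NatLE.trans ?_ hkt⟩
  have := (NatLE.refl s).mul hlk
  simpa only [mul_assoc] using this

theorem cosetOf_mul_congr {x y : S} (h : H.cosetOf x = H.cosetOf y) (s : S) :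
    H.cosetOf (s * x) = H.cosetOf (s * y) :=
  Set.Subset.antisymm (H.cosetOf_mul_subset h.subset s) (H.cosetOf_mul_subset h.symm.subset s)

theorem cosetOf_mul_idem (x : S) {e : S} (he : IsIdempotentElem e) (heH : e ∈ H.carrier) :
    H.cosetOf (x * e) = H.cosetOf x := by
  apply Set.Subset.antisymm
  · rintro t ⟨_, ⟨k, hk, rfl⟩, hkt⟩
    exact ⟨x * (e * k), ⟨e * k, H.mul_mem heH hk, rfl⟩, by rw [← mul_assoc]; exact hkt⟩
  · rintro t ⟨_, ⟨k, hk, rfl⟩, hkt⟩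
    refine ⟨x * e * k, ⟨k, hk, rfl⟩, NatLE.trans ?_ hkt⟩
    rw [mul_assoc]
    exact (NatLE.refl x).mul ⟨_, conj_idem he k, idem_mul_eq he k⟩

theorem dom_mem_of_cosetOf_eq {x y : S} (hx : dom x ∈ H.carrier) {s : S}
    (hy : dom y ∈ H.carrier) (h : H.cosetOf (s * x) = H.cosetOf y) :
    dom (s * x) ∈ H.carrier := by
  have h1 : s * x ∈ H.cosetOf y := by
    rw [← h]
    have := H.mul_mem_cosetOf (s * x) hx
    rwa [mul_assoc, mul_dom] at this
  obtain ⟨_, ⟨k, hk, rfl⟩, hkx⟩ := h1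
  refine H.up_mem ?_ (hkx.inv.mul hkx)
  have : (y * k)⁻¹ * (y * k) = k⁻¹ * (dom y * k) := by
    rw [mul_inv_rev']; unfold dom; simp only [mul_assoc]
  show (y * k)⁻¹ * (y * k) ∈ H.carrier
  rw [this]
  exact H.mul_mem (H.inv_mem hk) (H.mul_mem hy hk)

theorem cosetRel_functional (s : S) (A B B' : H.Coset) (h : H.cosetRel s A B)
    (h' : H.cosetRel s A B') : B = B' := by
  obtain ⟨x, -, hA, hB⟩ := h
  obtain ⟨y, -, hA', hB'⟩ := h'
  apply Subtype.ext
  rw [hB, hB']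
  exact H.cosetOf_mul_congr (hA.symm.trans hA') s

theorem cosetRel_injective (s : S) (A A' B : H.Coset) (h : H.cosetRel s A B)
    (h' : H.cosetRel s A' B) : A = A' := by
  have key : ∀ A : H.Coset, ∀ x : S, dom x ∈ H.carrier → A.1 = H.cosetOf x →
      B.1 = H.cosetOf (s * x) → A.1 = H.cosetOf (s⁻¹ * (s * x)) := by
    intro A x hx hA hB
    obtain ⟨z, hz, hBz⟩ := B.2
    have hd := H.dom_mem_of_cosetOf_eq hx hz (hB.symm.trans hBz)
    have e : s⁻¹ * (s * x) = x * dom (s * x) := by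
      calc s⁻¹ * (s * x) = dom s * x := by unfold dom; rw [mul_assoc]
        _ = x * dom (s * x) := by
          rw [idem_mul_eq (dom_idem s)]; unfold dom; rw [mul_inv_rev']; simp only [mul_assoc]
    rw [e, H.cosetOf_mul_idem x (dom_idem _) hd, hA]
  obtain ⟨x, hx, hA, hB⟩ := h
  obtain ⟨y, hy, hA', hB'⟩ := h'
  apply Subtype.ext
  rw [key A x hx hA hB, key A' y hy hA' hB']
  exact H.cosetOf_mul_congr (hB.symm.trans hB') s⁻¹

/-- The representation of `S` on the cosets with respect to `H`. -/
noncomputable def cosetSet : LeftSet S where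
  carrier := H.Coset
  act s := PEquiv.ofGraph (H.cosetRel s) (H.cosetRel_functional s) (H.cosetRel_injective s)
  act_mul s t := by
    apply PEquiv.ext
    intro A
    apply Option.ext
    intro B
    refine Iff.trans ?_ (PEquiv.mem_trans _ _ A B).symm
    refine (PEquiv.mem_ofGraph _ _ _ A B).trans ?_
    simp only [PEquiv.mem_ofGraph]
    constructor
    · rintro ⟨x, hx, hA, hB⟩
      obtain ⟨z, hz, hBz⟩ := B.2
      have hd := H.dom_mem_of_cosetOf_eq hx hz (hB.symm.trans hBz)
      have hd' : dom (t * x) ∈ H.carrier := by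
        refine H.up_mem hd ?_
        have e : dom (s * t * x) = (t * x)⁻¹ * (dom s * (t * x)) := by
          unfold dom; simp only [mul_inv_rev', mul_assoc]
        rw [e]
        exact (NatLE.refl _).mul ⟨_, conj_idem (dom_idem s) _, idem_mul_eq (dom_idem s) _⟩
      refine ⟨⟨H.cosetOf (t * x), t * x, hd', rfl⟩, ⟨x, hx, hA, rfl⟩, ⟨t * x, hd', rfl, ?_⟩⟩
      rw [hB, mul_assoc]
    · rintro ⟨C, ⟨x, hx, hA, hC⟩, ⟨y, hy, hC', hB⟩⟩
      refine ⟨x, hx, hA, ?_⟩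
      rw [hB, mul_assoc]
      exact H.cosetOf_mul_congr (hC'.symm.trans hC) s
  effective A := by
    obtain ⟨x, hx, hA⟩ := A.2
    refine ⟨ran x, A, ?_⟩
    rw [PEquiv.mem_ofGraph]
    exact ⟨x, hx, hA, by rw [ran_mul]; exact hA⟩

end ClosedInverseSubsemigroup

/-- Universal `S`-sets: those equivalent to the representation on the cosets with respect to
`F↑`, for some filter `F` in `E(S)`. -/
def LeftSet.isUniversal (S : Type u) [InverseSemigroup S] : ObjectProperty (LeftSet S) := fun X =>
  ∃ F : IdempotentFilter S, Nonempty (X ≅ F.up.cosetSet)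

/-! ### Directed, filtered and pullback preserving functors -/

/-- Directed functors: the category of elements is nonempty, and any two of its objects `i`, `j`
admit a diagram `i ⟵ k ⟶ j`. -/
def isDirectedFunctor (C : Type u) [SmallCategory C] : ObjectProperty (C ⥤ Type u) := fun A =>
  Nonempty A.Elements ∧ ∀ i j : A.Elements, ∃ k : A.Elements, Nonempty (k ⟶ i) ∧ Nonempty (k ⟶ j)

/-- Filtered functors: the category of elements is nonempty, any two of its objects `i`, `j` admit
a diagram `i ⟵ k ⟶ j`, and any parallel pair `i ⇉ j` is equalized by some `k ⟶ i`. This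
condition on the category of elements is called `IsCofiltered` in Mathlib. -/
def isFilteredFunctor (C : Type u) [SmallCategory C] : ObjectProperty (C ⥤ Type u) := fun A =>
  IsCofiltered A.Elements

/-- Directed functors that preserve pullbacks. -/
def isDirectedPullbackPreserving (C : Type u) [SmallCategory C] : ObjectProperty (C ⥤ Type u) :=
  fun A => isDirectedFunctor C A ∧ PreservesLimitsOfShape WalkingCospan A

/-! ### The functor `Φ` -/

namespace LeftSet

variable {S : Type u} [InverseSemigroup S]

/-- The domain of the action of `s`. -/
def Dom (X : LeftSet S) (s : S) : Type u := {x : X.carrier // ∃ y, y ∈ X.act s x}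

theorem act_isSome (X : LeftSet S) {e f : Loganathan S} (s : e ⟶ f) (x : X.Dom e.elt) :
    (X.act s.elt x.1).isSome := by
  obtain ⟨x, y, hy⟩ := x
  rw [← s.dom_eq, dom, mem_act_mul] at hy
  obtain ⟨z, hz, -⟩ := hy
  exact Option.isSome_iff_exists.2 ⟨z, hz⟩

/-- The translation map `x ↦ s · x` along an arrow `(f, s) : e ⟶ f` of `L(S)`. -/
def translate (X : LeftSet S) {e f : Loganathan S} (s : e ⟶ f) (x : X.Dom e.elt) :
    X.Dom f.elt :=
  ⟨(X.act s.elt x.1).get (X.act_isSome s x), by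
    have h : (X.act s.elt x.1).get (X.act_isSome s x) ∈ X.act s.elt x.1 := Option.get_mem _
    generalize (X.act s.elt x.1).get (X.act_isSome s x) = y at h
    have h' := h
    rw [← NatLE.mul_of_ran_le f.idem s.ran_le, mem_act_mul] at h'
    obtain ⟨z, hz, hz'⟩ := h'
    obtain rfl := Option.mem_unique h hz
    exact ⟨_, hz'⟩⟩

theorem translate_mem (X : LeftSet S) {e f : Loganathan S} (s : e ⟶ f) (x : X.Dom e.elt) :
    (X.translate s x).1 ∈ X.act s.elt x.1 := Option.get_mem _

/-- The functor `Φ(X) : L(S) ⥤ Sets`: `e` goes to the domain of the action of `e`, and the arrow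
`(f, s)` to the map `x ↦ s · x`. -/
def toFunctor (X : LeftSet S) : Loganathan S ⥤ Type u where
  obj e := X.Dom e.elt
  map s := ↾ (X.translate s)
  map_id e := by
    ext x
    apply Subtype.ext
    exact X.mem_act_idem e.idem (X.translate_mem (𝟙 e) x)
  map_comp {e f g} s t := by
    ext x
    apply Subtype.ext
    refine Option.mem_unique (X.translate_mem (s ≫ t) x) ?_
    exact (X.mem_act_mul t.elt s.elt _ _).2
      ⟨_, X.translate_mem s x, X.translate_mem t (X.translate s x)⟩

/-- The functor `Φ` from `S`-sets to functors on `L(S)`; a morphism `f` goes to the natural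
transformation given by the restrictions of `f`. -/
def Phi (S : Type u) [InverseSemigroup S] : LeftSet S ⥤ (Loganathan S ⥤ Type u) where
  obj X := X.toFunctor
  map {X Y} f :=
    { app := fun e => ↾ (fun x : X.Dom e.elt =>
        (⟨f.toFun x.1, by
          obtain ⟨y, hy⟩ := x.2
          exact ⟨f.toFun y, f.map_act _ _ _ hy⟩⟩ : Y.Dom e.elt))
      naturality := by
        intro e e' s
        ext x
        apply Subtype.ext
        refine Option.mem_unique (f.map_act _ _ _ (X.translate_mem s x)) ?_
        obtain ⟨y, hy⟩ := x.2
        exact Y.translate_mem s ⟨f.toFun x.1, f.toFun y, f.map_act _ _ _ hy⟩ }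
  map_id X := rfl
  map_comp f g := rfl

end LeftSet

/-! ### The construction `Ψ` -/

namespace PsiConstruction

variable {S : Type u} [InverseSemigroup S]

/-- The relation `(e, x) ∼ (e', F(e', e)(x))`, for idempotents `e ≤ e'` and `x ∈ F(e)`, on the
disjoint union of the sets `F(e)`. -/
inductive Rel (F : Loganathan S ⥤ Type u) :
    (Σ e : Loganathan S, F.obj e) → (Σ e : Loganathan S, F.obj e) → Prop
  | glue {e e' : Loganathan S} (h : NatLE e.elt e'.elt) (x : F.obj e) :
      Rel F ⟨e, x⟩ ⟨e', F.map (Loganathan.incl h) x⟩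

/-- The set `Ψ(F)`: the quotient of the disjoint union of the sets `F(e)` by the equivalence
relation generated by `Rel F`, that is, the colimit of the restriction of `F` to `E(S)`. -/
def Carrier (F : Loganathan S ⥤ Type u) : Type u := Quot (Rel F)

/-- The class `[e, x]`. -/
def mk (F : Loganathan S ⥤ Type u) (e : Loganathan S) (x : F.obj e) : Carrier F :=
  Quot.mk _ ⟨e, x⟩

/-- The graph of the action of `s` on `Ψ(F)`: `s ∘ [d(s), x] = [r(s), F(r(s), s)(x)]`, and
`s ∘ α` is undefined if `α` is not of the form `[d(s), x]`. -/
def ActRel (F : Loganathan S ⥤ Type u) (s : S) (α β : Carrier F) : Prop :=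
  ∃ x : F.obj (Loganathan.domObj s),
    α = mk F (Loganathan.domObj s) x ∧ β = mk F (Loganathan.ranObj s) (F.map (Loganathan.arrow s) x)

/-- The functor `G`, defined on a full subcategory of the category of functors on `L(S)`, is
(naturally isomorphic to) the functor `Ψ`, which sends `F` to the set `Ψ(F)` with the action
above, and a natural transformation `a` to the map `[e, x] ↦ [e, a_e(x)]`. -/
def IsPsi {P : ObjectProperty (Loganathan S ⥤ Type u)} (G : P.FullSubcategory ⥤ LeftSet S) :
    Prop :=
  ∃ b : ∀ F : P.FullSubcategory, Carrier F.obj ≃ (G.obj F).carrier,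
    (∀ (F : P.FullSubcategory) (s : S) (α β : Carrier F.obj),
      b F β ∈ (G.obj F).act s (b F α) ↔ ActRel F.obj s α β) ∧
    (∀ (F F' : P.FullSubcategory) (a : F ⟶ F') (e : Loganathan S) (x : F.obj.obj e),
      (G.map a).toFun (b F (mk F.obj e x)) = b F' (mk F'.obj e (a.hom.app e x)))

end PsiConstruction

/-! ### Geometric morphisms and points -/

/-- A geometric morphism from `𝓕` to `𝓔`. -/
structure GeometricMorphism (𝓕 : Type u₁) [Category.{v₁} 𝓕] (𝓔 : Type u₂) [Category.{v₂} 𝓔] where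
  inverseImage : 𝓔 ⥤ 𝓕
  directImage : 𝓕 ⥤ 𝓔
  adj : inverseImage ⊣ directImage
  leftExact : PreservesFiniteLimits inverseImage

/-- The category of geometric morphisms; the morphisms are the natural transformations between the
inverse image functors. -/
instance (𝓕 : Type u₁) [Category.{v₁} 𝓕] (𝓔 : Type u₂) [Category.{v₂} 𝓔] :
    Category (GeometricMorphism 𝓕 𝓔) :=
  inferInstanceAs (Category (InducedCategory (𝓔 ⥤ 𝓕) GeometricMorphism.inverseImage))

/-- The classifying topos `B(S)` of an inverse semigroup: presheaves of sets on `L(S)`. -/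
abbrev ClassifyingTopos (S : Type u) [InverseSemigroup S] : Type (u + 1) :=
  (Loganathan S)ᵒᵖ ⥤ Type u

/-- The category of points of a topos `𝓔`: geometric morphisms from `Sets` to `𝓔`. -/
abbrev ToposPoint (𝓔 : Type u₂) [Category.{v₂} 𝓔] := GeometricMorphism (Type u) 𝓔

/-!
Everything rests on the shape of `L(S)`: its arrows are monomorphisms, since `s` is recovered from
`t s` by multiplication with `t⁻¹`, and the pullback of `s : e ⟶ g` and `t : f ⟶ g` is the
idempotent `h = r(s) r(t)` with projections `s⁻¹ h` and `t⁻¹ h`. Hence a functor to sets preserves pullbacks if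
and only if it is injective on arrows and lifts compatible pairs to these pullbacks
(`Loganathan.preservesPullbacks_of_lift`), and `Φ(X)` does so for every `S`-set `X`.

Conversely, if `F` preserves pullbacks, two elements have the same class in `Ψ(F)` if and only if
they come from one element over a smaller idempotent (`PsiConstruction.mk_eq_mk_iff`). So each
`F(e)` embeds in `Ψ(F)`, the action is by partial bijections, and `[e, x] ↦ x` and `x ↦ [e, x]` give
isomorphisms `Ψ(Φ(X)) ≅ X` and `F ≅ Φ(Ψ(F))`. Directedness of the functor is transitivity of the
`S`-set.

Under this correspondence, the equalizing condition on the category of elements is freeness of the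
action. A torsor with base point `x` is the set of cosets with respect to the idempotents fixing
`x`: the point `y` corresponds to the coset `{t | t x = y}`.

Points of a presheaf topos are described by restriction to representables
(`ToposPoint.restriction`). An inverse image preserves colimits, so it is the left Kan extension of
its restriction, which makes the restriction functor fully faithful. The restriction is filtered by
left exactness, and a filtered functor extends to a left exact functor because filtered colimits
commute with finite limits.
-/

/-! ### The natural partial order -/

namespace InverseSemigroup

variable {S : Type u} [InverseSemigroup S]

theorem dom_of_idem {e : S} (he : IsIdempotentElem e) : dom e = e := by
  rw [dom, inv_idem he, he.eq]

theorem ran_of_idem {e : S} (he : IsIdempotentElem e) : ran e = e := by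
  rw [ran, inv_idem he, he.eq]

theorem natLE_idem_iff {e f : S} (he : IsIdempotentElem e) (hf : IsIdempotentElem f) :
    NatLE e f ↔ f * e = e := by
  refine ⟨fun h => NatLE.mul_of_ran_le hf (by rwa [ran_of_idem he]), fun h => ⟨e, he, h.symm⟩⟩

theorem natLE_mul_idem (s : S) {e : S} (he : IsIdempotentElem e) : NatLE (s * e) s :=
  ⟨e, he, rfl⟩

theorem natLE_idem_mul (s : S) {e : S} (he : IsIdempotentElem e) : NatLE (e * s) s :=
  ⟨_, conj_idem he s, idem_mul_eq he s⟩

theorem NatLE.eq_mul_dom {s t : S} (h : NatLE s t) : s = t * dom s := by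
  obtain ⟨e, he, h⟩ := h
  have h1 : s * e = s := by rw [h, mul_assoc, he.eq]
  have h2 : e * dom s = dom s := by
    rw [idem_comm he (dom_idem s), dom, mul_assoc, h1]
  calc s = s * dom s := (mul_dom s).symm
    _ = t * dom s := by rw [h, mul_assoc, ← h, h2]

theorem NatLE.dom_le {s t : S} (h : NatLE s t) : NatLE (dom s) (dom t) := h.inv.mul h

theorem NatLE.idem {e s : S} (h : NatLE s e) (he : IsIdempotentElem e) : IsIdempotentElem s := by
  obtain ⟨f, hf, rfl⟩ := h
  exact idem_mul he hf

theorem dom_mul_idem {s e : S} (he : IsIdempotentElem e) (h : NatLE e (dom s)) :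
    dom (s * e) = e := by
  have h' := (natLE_idem_iff he (dom_idem s)).1 h
  rw [dom, mul_inv_rev', inv_idem he, mul_assoc, ← mul_assoc s⁻¹]
  change e * (dom s * e) = e
  rw [h', he.eq]

theorem dom_mul (s t : S) : dom (s * t) = t⁻¹ * dom s * t := by
  simp only [dom, mul_inv_rev', mul_assoc]

theorem dom_inv (s : S) : dom s⁻¹ = ran s := by rw [dom, ran, inv_inv']

end InverseSemigroup

/-! ### Arrows of Loganathan's category -/

namespace Loganathan

variable {S : Type u} [InverseSemigroup S]

/-- The arrow `e ⟶ f` of `L(S)` given by an element `s` with `d(s) = e` and `f s = s`. -/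
def homMk {e f : Loganathan S} (s : S) (h : dom s = e.elt) (h' : f.elt * s = s) : e ⟶ f :=
  (⟨s, h, ran_le_of_mul h'⟩ : Hom e f)

@[simp]
theorem homMk_elt {e f : Loganathan S} (s : S) (h : dom s = e.elt) (h' : f.elt * s = s) :
    (homMk s h h' : e ⟶ f).elt = s := rfl

@[simp]
theorem comp_elt {e f g : Loganathan S} (u : e ⟶ f) (v : f ⟶ g) :
    (u ≫ v).elt = v.elt * u.elt := rfl

theorem hom_ext {e f : Loganathan S} {u v : e ⟶ f} (h : u.elt = v.elt) : u = v := Hom.ext h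

theorem mul_elt {e f : Loganathan S} (u : e ⟶ f) : f.elt * u.elt = u.elt :=
  NatLE.mul_of_ran_le f.idem u.ran_le

theorem inv_mul_elt {e f : Loganathan S} (u : e ⟶ f) : u.elt⁻¹ * u.elt = e.elt := u.dom_eq

theorem map_map (F : Loganathan S ⥤ Type u) {e f g : Loganathan S} {u : e ⟶ f} {v : f ⟶ g}
    {w : e ⟶ g} (h : v.elt * u.elt = w.elt) (x : F.obj e) :
    F.map v (F.map u x) = F.map w x := by
  rw [← Functor.map_comp_apply, show u ≫ v = w from hom_ext h]

theorem incl_mul {g e f : Loganathan S} (h : NatLE g.elt e.elt) (h' : NatLE e.elt f.elt) :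
    (incl h').elt * (incl h).elt = (incl (h.trans h')).elt :=
  (natLE_idem_iff g.idem e.idem).1 h

/-- The meet `e f` of two idempotents, as an object of `L(S)`. -/
def meet (e f : Loganathan S) : Loganathan S := ⟨e.elt * f.elt, idem_mul e.idem f.idem⟩

theorem meet_le_left (e f : Loganathan S) : NatLE (meet e f).elt e.elt :=
  natLE_mul_idem _ f.idem

theorem meet_le_right (e f : Loganathan S) : NatLE (meet e f).elt f.elt :=
  natLE_idem_mul _ e.idem

theorem hom_mul_left_cancel {e f g h : Loganathan S} (u : f ⟶ g) {a : e ⟶ f} {b : h ⟶ f}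
    (H : u.elt * a.elt = u.elt * b.elt) : a.elt = b.elt := by
  rw [← mul_elt a, ← mul_elt b, ← inv_mul_elt u, mul_assoc, H, mul_assoc]

instance {e f : Loganathan S} (u : e ⟶ f) : Mono u where
  right_cancellation _ _ h := hom_ext (hom_mul_left_cancel u (congrArg Hom.elt h))

/-! ### Pullbacks in Loganathan's category -/

section Pullback

variable {e f g : Loganathan S} (s : e ⟶ g) (t : f ⟶ g)

/-- The vertex `r(s) r(t)` of the pullback of `s` and `t`. -/
def pullbackObj : Loganathan S := meet (ranObj s.elt) (ranObj t.elt)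

theorem pullbackObj_mul_left : ran s.elt * (pullbackObj s t).elt = (pullbackObj s t).elt :=
  (natLE_idem_iff (pullbackObj s t).idem (ran_idem _)).1 (meet_le_left _ _)

theorem pullbackObj_mul_right : ran t.elt * (pullbackObj s t).elt = (pullbackObj s t).elt :=
  (natLE_idem_iff (pullbackObj s t).idem (ran_idem _)).1 (meet_le_right _ _)

/-- The projection `s⁻¹ r(s) r(t)` of the pullback of `s` and `t`. -/
def pullbackFst : pullbackObj s t ⟶ e :=
  homMk (s.elt⁻¹ * (pullbackObj s t).elt)
    (dom_mul_idem (pullbackObj s t).idem (by rw [dom_inv]; exact meet_le_left _ _))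
    (by rw [← inv_mul_elt s, ← mul_assoc, inv_mul_inv])

/-- The projection `t⁻¹ r(s) r(t)` of the pullback of `s` and `t`. -/
def pullbackSnd : pullbackObj s t ⟶ f :=
  homMk (t.elt⁻¹ * (pullbackObj s t).elt)
    (dom_mul_idem (pullbackObj s t).idem (by rw [dom_inv]; exact meet_le_right _ _))
    (by rw [← inv_mul_elt t, ← mul_assoc, inv_mul_inv])

theorem pullbackFst_comp_elt : (pullbackFst s t ≫ s).elt = (pullbackObj s t).elt := by
  simp only [comp_elt, pullbackFst, homMk_elt, ← mul_assoc]
  exact pullbackObj_mul_left s t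

theorem pullbackSnd_comp_elt : (pullbackSnd s t ≫ t).elt = (pullbackObj s t).elt := by
  simp only [comp_elt, pullbackSnd, homMk_elt, ← mul_assoc]
  exact pullbackObj_mul_right s t

theorem isPullback : IsPullback (pullbackFst s t) (pullbackSnd s t) s t where
  w := hom_ext (by rw [pullbackFst_comp_elt, pullbackSnd_comp_elt])
  isLimit' := ⟨PullbackCone.IsLimit.mk _
    (fun c => homMk (s.elt * c.fst.elt) (c.fst ≫ s).dom_eq (by
      have h1 : t.elt * c.snd.elt = s.elt * c.fst.elt := (congrArg Hom.elt c.condition).symm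
      change ran s.elt * ran t.elt * _ = _
      rw [mul_assoc, ← h1, ← mul_assoc (ran t.elt), ran_mul, h1, ← mul_assoc, ran_mul]))
    (fun c => by
      rw [← cancel_mono s]
      apply hom_ext
      rw [Category.assoc, comp_elt, pullbackFst_comp_elt, mul_elt]
      rfl)
    (fun c => by
      rw [← cancel_mono t]
      apply hom_ext
      rw [Category.assoc, comp_elt, pullbackSnd_comp_elt, mul_elt]
      exact congrArg Hom.elt c.condition)
    (fun c m h _ => by
      apply hom_ext
      change m.elt = s.elt * c.fst.elt
      rw [← h, comp_elt, ← mul_assoc]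
      change _ = (pullbackFst s t ≫ s).elt * _
      rw [pullbackFst_comp_elt, mul_elt])⟩

end Pullback

/-- Since every cospan of `L(S)` has an explicit pullback, and every arrow of `L(S)` is a
monomorphism, preservation of pullbacks by a functor to sets is injectivity on arrows together
with lifting of compatible pairs to the explicit pullbacks. -/
theorem preservesPullbacks_of_lift (F : Loganathan S ⥤ Type u)
    (hinj : ∀ {e f : Loganathan S} (u : e ⟶ f), Function.Injective (F.map u))
    (hlift : ∀ {e f g : Loganathan S} (s : e ⟶ g) (t : f ⟶ g) (x : F.obj e) (y : F.obj f),
      F.map s x = F.map t y →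
        ∃ z, F.map (pullbackFst s t) z = x ∧ F.map (pullbackSnd s t) z = y) :
    PreservesLimitsOfShape WalkingCospan F where
  preservesLimit {K} := by
    have key {e f g : Loganathan S} (s : e ⟶ g) (t : f ⟶ g) : PreservesLimit (cospan s t) F := by
      refine preservesLimit_of_preserves_limit_cone (isPullback s t).isLimit ?_
      refine (isLimitMapConePullbackConeEquiv F (isPullback s t).w).symm ?_
      refine IsPullback.isLimit ((Types.isPullback_iff _ _ _ _).2 ⟨?_, ?_, ?_⟩)
      · rw [← F.map_comp, (isPullback s t).w, F.map_comp]
      · exact fun x y h => hinj _ h.1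
      · exact fun x y h => hlift s t x y h
    exact preservesLimit_of_iso_diagram F (diagramIsoCospan K).symm

theorem map_injective (F : Loganathan S ⥤ Type u) [PreservesLimitsOfShape WalkingCospan F]
    {e f : Loganathan S} (u : e ⟶ f) : Function.Injective (F.map u) :=
  (mono_iff_injective _).1 inferInstance

theorem exists_lift (F : Loganathan S ⥤ Type u) [PreservesLimitsOfShape WalkingCospan F]
    {e f g : Loganathan S} (s : e ⟶ g) (t : f ⟶ g) (x : F.obj e) (y : F.obj f)
    (h : F.map s x = F.map t y) :
    ∃ z, F.map (pullbackFst s t) z = x ∧ F.map (pullbackSnd s t) z = y :=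
  ((Types.isPullback_iff _ _ _ _).1 ((isPullback s t).map F)).2.2 x y h

end Loganathan

/-! ### Partial actions -/

namespace LeftSet

variable {S : Type u} [InverseSemigroup S] (X : LeftSet S)

theorem mem_act_dom {s : S} {x y : X.carrier} (h : y ∈ X.act s x) : x ∈ X.act (dom s) x := by
  have h' := h
  rw [← mul_dom s, mem_act_mul] at h'
  obtain ⟨z, hz, -⟩ := h'
  rwa [X.mem_act_idem (dom_idem s) hz] at hz

theorem mem_act_inv (s : S) (x y : X.carrier) : x ∈ X.act s⁻¹ y ↔ y ∈ X.act s x := by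
  have key {s : S} {x y : X.carrier} (h : y ∈ X.act s x) : x ∈ X.act s⁻¹ y := by
    obtain ⟨z, hz, hz'⟩ := (X.mem_act_mul _ _ _ _).1 (X.mem_act_dom h)
    rwa [Option.mem_unique h hz]
  exact ⟨fun h => by simpa only [inv_inv'] using key h, key⟩

theorem mem_act_of_natLE {s t : S} (h : NatLE s t) {x y : X.carrier} (hy : y ∈ X.act s x) :
    y ∈ X.act t x := by
  obtain ⟨e, he, rfl⟩ := h
  obtain ⟨z, hz, hz'⟩ := (X.mem_act_mul _ _ _ _).1 hy
  rwa [X.mem_act_idem he hz] at hz'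

theorem mem_act_mul_idem {s e : S} {x y : X.carrier} (hx : x ∈ X.act e x) :
    y ∈ X.act (s * e) x ↔ y ∈ X.act s x := by
  rw [mem_act_mul]
  refine ⟨fun ⟨z, hz, hy⟩ => by rwa [Option.mem_unique hx hz], fun hy => ⟨x, hx, hy⟩⟩

theorem mem_act_self_iff {e : S} (he : IsIdempotentElem e) (x : X.carrier) :
    x ∈ X.act e x ↔ ∃ y, y ∈ X.act e x :=
  ⟨fun h => ⟨x, h⟩, fun ⟨y, hy⟩ => by rwa [X.mem_act_idem he hy] at hy⟩

end LeftSet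

/-! ### The `S`-set `Ψ(F)` -/

namespace PsiConstruction

open Loganathan

variable {S : Type u} [InverseSemigroup S] (F : Loganathan S ⥤ Type u)

theorem mk_map_of_idem {e f : Loganathan S} (u : e ⟶ f) (hu : u.elt = e.elt) (x : F.obj e) :
    mk F f (F.map u x) = mk F e x := by
  have h : NatLE e.elt f.elt := by rw [← hu, natLE_idem_iff (hu ▸ e.idem) f.idem, mul_elt]
  obtain rfl : u = incl h := hom_ext hu
  exact (Quot.sound (Rel.glue h x)).symm

theorem mk_surjective (α : Carrier F) : ∃ (e : Loganathan S) (x : F.obj e), mk F e x = α := by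
  obtain ⟨⟨e, x⟩, rfl⟩ := Quot.exists_rep α
  exact ⟨e, x, rfl⟩

/-- The class of `F(u)(x)` only depends on the underlying element of `u` and not on its target. -/
theorem mk_map_congr {e f f' : Loganathan S} (u : e ⟶ f) (u' : e ⟶ f') (h : u.elt = u'.elt)
    (x : F.obj e) : mk F f (F.map u x) = mk F f' (F.map u' x) := by
  have key {f : Loganathan S} (v : e ⟶ f) (hv : v.elt = u.elt) :
      mk F f (F.map v x) = mk F (ranObj u.elt)
        (F.map (homMk u.elt u.dom_eq (ran_mul _) : e ⟶ ranObj u.elt) x) := by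
    have hle : NatLE (ranObj u.elt).elt f.elt := hv ▸ v.ran_le
    rw [← mk_map_of_idem F (incl hle) rfl, map_map F (w := v)]
    exact (ran_mul u.elt).trans hv.symm
  rw [key u rfl, key u' h.symm]

/-- The action on `Ψ(F)` in terms of arbitrary arrows of `L(S)` lying below `s`. -/
theorem actRel_iff (s : S) (α β : Carrier F) :
    ActRel F s α β ↔ ∃ (e f : Loganathan S) (u : e ⟶ f) (x : F.obj e),
      NatLE u.elt s ∧ α = mk F e x ∧ β = mk F f (F.map u x) := by
  constructor
  · rintro ⟨x, hα, hβ⟩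
    exact ⟨_, _, arrow s, x, NatLE.refl s, hα, hβ⟩
  · rintro ⟨e, f, u, x, hu, rfl, rfl⟩
    have hle : NatLE e.elt (domObj s).elt := by rw [← u.dom_eq]; exact hu.dom_le
    refine ⟨F.map (incl hle) x, (mk_map_of_idem F _ rfl x).symm, ?_⟩
    rw [← Functor.map_comp_apply]
    apply mk_map_congr
    exact hu.eq_mul_dom.trans (by rw [u.dom_eq]; rfl)

variable [PreservesLimitsOfShape WalkingCospan F]

/-- If `F` preserves pullbacks, then two elements have the same class in `Ψ(F)` if and only if they
come from a common element over a smaller idempotent; transitivity of this relation is where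
pullbacks are used. -/
theorem mk_eq_mk_iff {e f : Loganathan S} (x : F.obj e) (y : F.obj f) :
    mk F e x = mk F f y ↔ ∃ (g : Loganathan S) (h : NatLE g.elt e.elt) (h' : NatLE g.elt f.elt)
      (z : F.obj g), F.map (incl h) z = x ∧ F.map (incl h') z = y := by
  let R (p q : Σ e : Loganathan S, F.obj e) : Prop :=
    ∃ (g : Loganathan S) (h : NatLE g.elt p.1.elt) (h' : NatLE g.elt q.1.elt)
      (z : F.obj g), F.map (incl h) z = p.2 ∧ F.map (incl h') z = q.2
  have incl_refl (e : Loganathan S) (h : NatLE e.elt e.elt) : incl h = 𝟙 e := rfl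
  constructor
  · intro h
    have hgen : Relation.EqvGen (Rel F) ⟨e, x⟩ ⟨f, y⟩ := Quot.eqvGen_exact h
    suffices H : ∀ p q, Relation.EqvGen (Rel F) p q → R p q from H _ _ hgen
    intro p q hpq
    induction hpq with
    | rel p q h =>
      obtain ⟨h, x⟩ := h
      exact ⟨_, NatLE.refl _, h, x, by rw [incl_refl, F.map_id]; rfl, rfl⟩
    | refl p => exact ⟨_, NatLE.refl _, NatLE.refl _, p.2, by rw [incl_refl, F.map_id]; rfl,
        by rw [incl_refl, F.map_id]; rfl⟩
    | symm p q _ ih =>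
      obtain ⟨g, h, h', z, hz, hz'⟩ := ih
      exact ⟨g, h', h, z, hz', hz⟩
    | trans p q r _ _ ih ih' =>
      obtain ⟨g, hp, hq, a, ha, ha'⟩ := ih
      obtain ⟨k, kq, kr, b, hb, hb'⟩ := ih'
      obtain ⟨c, hc, hc'⟩ := exists_lift F (incl hq) (incl kq) a b (ha'.trans hb.symm)
      have hlg : NatLE (pullbackObj (incl hq) (incl kq)).elt g.elt := by
        exact (meet_le_left (ranObj g.elt) (ranObj k.elt)).trans (ran_le_of_mul g.idem)
      have hlk : NatLE (pullbackObj (incl hq) (incl kq)).elt k.elt := by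
        exact (meet_le_right (ranObj g.elt) (ranObj k.elt)).trans (ran_le_of_mul k.idem)
      have hfst : pullbackFst (incl hq) (incl kq) = incl hlg := by
        rw [← cancel_mono (incl hq)]
        exact hom_ext ((pullbackFst_comp_elt _ _).trans
          ((natLE_idem_iff (Loganathan.idem _) g.idem).1 hlg).symm)
      have hsnd : pullbackSnd (incl hq) (incl kq) = incl hlk := by
        rw [← cancel_mono (incl kq)]
        exact hom_ext ((pullbackSnd_comp_elt _ _).trans
          ((natLE_idem_iff (Loganathan.idem _) k.idem).1 hlk).symm)
      refine ⟨_, hlg.trans hp, hlk.trans kr, c, ?_, ?_⟩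
      · rw [← ha, ← hc, hfst, map_map F (incl_mul _ _)]
      · rw [← hb', ← hc', hsnd, map_map F (incl_mul _ _)]
  · rintro ⟨g, h, h', z, rfl, rfl⟩
    rw [mk_map_of_idem F _ rfl, mk_map_of_idem F _ rfl]

theorem mk_injective (e : Loganathan S) : Function.Injective (mk F e) := by
  intro x y h
  obtain ⟨g, h, h', z, rfl, rfl⟩ := (mk_eq_mk_iff F x y).1 h
  rfl

theorem actRel_functional (s : S) (α β β' : Carrier F) (h : ActRel F s α β)
    (h' : ActRel F s α β') : β = β' := by
  obtain ⟨x, rfl, rfl⟩ := h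
  obtain ⟨y, hy, rfl⟩ := h'
  rw [mk_injective F _ hy]

theorem actRel_injective (s : S) (α α' β : Carrier F) (h : ActRel F s α β)
    (h' : ActRel F s α' β) : α = α' := by
  obtain ⟨x, rfl, rfl⟩ := h
  obtain ⟨y, rfl, hy⟩ := h'
  rw [map_injective F _ (mk_injective F _ hy)]

theorem actRel_mul_iff (s t : S) (α γ : Carrier F) :
    ActRel F (s * t) α γ ↔ ∃ β, ActRel F t α β ∧ ActRel F s β γ := by
  constructor
  · rintro ⟨x, rfl, rfl⟩
    -- Restricting `t` to `d(st)` gives an arrow into `d(s)`, which factors the action of `s t`.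
    have hd := dom_mul s t
    have hdom : dom s * (t * dom (s * t)) = t * dom (s * t) := by
      rw [hd, ← idem_mul_eq (dom_idem s), ← mul_assoc, (dom_idem s).eq]
    have hle : NatLE (dom (s * t)) (dom t) := by
      rw [natLE_idem_iff (dom_idem _) (dom_idem _), hd, dom, ← mul_assoc, ← mul_assoc, inv_mul_inv]
    let u : domObj (s * t) ⟶ domObj s :=
      homMk (t * dom (s * t)) (dom_mul_idem (dom_idem _) hle) hdom
    refine ⟨mk F (domObj s) (F.map u x), ?_, ?_⟩
    · rw [actRel_iff]
      exact ⟨_, _, u, x, natLE_mul_idem _ (dom_idem _), rfl, rfl⟩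
    · refine ⟨_, rfl, ?_⟩
      rw [← Functor.map_comp_apply]
      apply mk_map_congr
      change s * t = s * (t * dom (s * t))
      rw [← mul_assoc, mul_dom]
  · rintro ⟨_, ⟨y, rfl, rfl⟩, ⟨z, hz, rfl⟩⟩
    -- The intermediate point comes from some `c` over `g ≤ r(t), d(s)`; pulling `c` back along `t`
    -- gives a representative of the initial point over `d(st)`.
    obtain ⟨g, h, h', c, hc, rfl⟩ := (mk_eq_mk_iff F _ _).1 hz
    change NatLE g.elt (ran t) at h
    change NatLE g.elt (dom s) at h'
    have hg : t * (t⁻¹ * g.elt) = g.elt := by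
      rw [← mul_assoc]; exact (natLE_idem_iff g.idem (ran_idem t)).1 h
    have hgd : dom (t⁻¹ * g.elt) = g.elt := dom_mul_idem g.idem (by rwa [dom_inv])
    let u : g ⟶ domObj t := homMk (t⁻¹ * g.elt) hgd (by
      rw [← mul_assoc]; exact congrArg (· * g.elt) (inv_mul_inv t))
    have hy : F.map u c = y := by
      apply map_injective F (arrow t)
      rw [← hc]
      exact map_map F hg c
    have hs : dom s * g.elt = g.elt := (natLE_idem_iff g.idem (dom_idem s)).1 h'
    let v : g ⟶ domObj (s * t) := homMk (t⁻¹ * g.elt) hgd (by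
      change dom (s * t) * _ = _
      rw [dom_mul, mul_assoc, hg, mul_assoc, hs])
    refine ⟨F.map v c, ?_, ?_⟩
    · rw [← hy]
      exact mk_map_congr F u v rfl c
    · rw [← Functor.map_comp_apply, ← Functor.map_comp_apply]
      apply mk_map_congr
      change s * g.elt = s * t * (t⁻¹ * g.elt)
      rw [mul_assoc, hg]

/-- The `S`-set `Ψ(F)` of a pullback preserving functor `F`. -/
noncomputable def toLeftSet : LeftSet S where
  carrier := Carrier F
  act s := PEquiv.ofGraph (ActRel F s) (actRel_functional F s) (actRel_injective F s)
  act_mul s t := by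
    ext α γ
    refine Iff.trans ?_ (PEquiv.mem_trans _ _ α γ).symm
    refine (PEquiv.mem_ofGraph _ _ _ α γ).trans ?_
    simp only [PEquiv.mem_ofGraph]
    exact actRel_mul_iff F s t α γ
  effective α := by
    obtain ⟨e, x, rfl⟩ := mk_surjective F α
    exact ⟨e.elt, mk F e (F.map (𝟙 e) x), (PEquiv.mem_ofGraph _ _ _ _ _).2
      ((actRel_iff F _ _ _).2 ⟨e, e, 𝟙 e, x, NatLE.refl _, rfl, rfl⟩)⟩

theorem mem_toLeftSet_act (s : S) (α β : Carrier F) :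
    β ∈ (toLeftSet F).act s α ↔ ActRel F s α β :=
    PEquiv.mem_ofGraph _ (actRel_functional F s) (actRel_injective F s) α β

theorem mk_map_mem_act {e f : Loganathan S} (u : e ⟶ f) (x : F.obj e) :
    mk F f (F.map u x) ∈ (toLeftSet F).act u.elt (mk F e x) :=
  (mem_toLeftSet_act _ _ _ _).2 ((actRel_iff F _ _ _).2 ⟨_, _, u, x, NatLE.refl _, rfl, rfl⟩)

theorem isTransitive_toLeftSet (hF : isDirectedFunctor (Loganathan S) F) :
    LeftSet.isTransitive S (toLeftSet F) := by
  obtain ⟨⟨⟨e, x⟩⟩, hF⟩ := hF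
  refine ⟨⟨mk F e x⟩, fun α β => ?_⟩
  obtain ⟨e, x, rfl⟩ := mk_surjective F α
  obtain ⟨f, y, rfl⟩ := mk_surjective F β
  obtain ⟨⟨k, z⟩, ⟨(u : k ⟶ e), (hu : F.map u z = x)⟩, ⟨(v : k ⟶ f), (hv : F.map v z = y)⟩⟩ :=
    hF ⟨e, x⟩ ⟨f, y⟩
  subst hu hv
  exact ⟨v.elt * u.elt⁻¹, (LeftSet.mem_act_mul _ _ _ _ _).2
    ⟨mk F k z, (LeftSet.mem_act_inv _ _ _ _).2 (mk_map_mem_act F u z), mk_map_mem_act F v z⟩⟩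

/-- The map `Ψ(F) → Ψ(F')` induced by a natural transformation. -/
def mapCarrier {F F' : Loganathan S ⥤ Type u} (a : F ⟶ F') : Carrier F → Carrier F' :=
  Quot.map (fun p => ⟨p.1, a.app p.1 p.2⟩) (by
    rintro _ _ ⟨h, x⟩
    dsimp only
    rw [NatTrans.naturality_apply]
    exact Rel.glue h _)

theorem actRel_mapCarrier {F F' : Loganathan S ⥤ Type u} (a : F ⟶ F') {s : S} {α β : Carrier F}
    (h : ActRel F s α β) : ActRel F' s (mapCarrier a α) (mapCarrier a β) := by
  obtain ⟨x, rfl, rfl⟩ := h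
  exact ⟨a.app _ x, rfl, congrArg (mk F' _) (NatTrans.naturality_apply a _ x)⟩

instance (A : (isDirectedPullbackPreserving (Loganathan S)).FullSubcategory) :
    PreservesLimitsOfShape WalkingCospan A.obj := A.property.2

variable (S) in
/-- The functor `Ψ` on pullback preserving directed functors, with values in transitive
`S`-sets. -/
noncomputable def Psi : (isDirectedPullbackPreserving (Loganathan S)).FullSubcategory ⥤
    (LeftSet.isTransitive S).FullSubcategory where
  obj A := ⟨toLeftSet A.obj, isTransitive_toLeftSet A.obj A.property.1⟩
  map {A B} a := ObjectProperty.homMk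
    { toFun := mapCarrier a.hom
      map_act := fun s α β h => (mem_toLeftSet_act B.obj s _ _).2
        (actRel_mapCarrier a.hom ((mem_toLeftSet_act A.obj s α β).1 h)) }
  map_id A := by
    apply ObjectProperty.hom_ext
    apply LeftSet.Hom.ext
    funext α
    obtain ⟨e, x, rfl⟩ := mk_surjective _ α
    rfl
  map_comp a b := by
    apply ObjectProperty.hom_ext
    apply LeftSet.Hom.ext
    funext α
    obtain ⟨e, x, rfl⟩ := mk_surjective _ α
    rfl

end PsiConstruction

/-! ### The functor `Φ(X)` -/

namespace LeftSet

open Loganathan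

variable {S : Type u} [InverseSemigroup S] (X : LeftSet S)

theorem mem_act_ran {s : S} {x y : X.carrier} (h : y ∈ X.act s x) : y ∈ X.act (ran s) y := by
  rw [← dom_inv]
  exact X.mem_act_dom ((X.mem_act_inv s x y).2 h)

variable {X}

theorem Dom.mem_act {e : S} (he : IsIdempotentElem e) (x : X.Dom e) : x.1 ∈ X.act e x.1 :=
  (X.mem_act_self_iff he x.1).2 x.2

theorem translate_val_eq_iff {e f : Loganathan S} (u : e ⟶ f) (x : X.Dom e.elt) (y : X.carrier) :
    (X.translate u x).1 = y ↔ y ∈ X.act u.elt x.1 :=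
  ⟨fun h => h ▸ X.translate_mem u x, fun h => Option.mem_unique (X.translate_mem u x) h⟩

theorem translate_eq_iff {e f : Loganathan S} (u : e ⟶ f) (x : X.Dom e.elt) (y : X.Dom f.elt) :
    X.translate u x = y ↔ y.1 ∈ X.act u.elt x.1 :=
  Subtype.ext_iff.trans (translate_val_eq_iff u x y.1)

theorem translate_incl_val {e f : Loganathan S} (h : NatLE e.elt f.elt) (x : X.Dom e.elt) :
    (X.translate (incl h) x).1 = x.1 :=
  (translate_val_eq_iff _ _ _).2 (x.mem_act e.idem)

variable (X)

instance preservesPullbacks_toFunctor : PreservesLimitsOfShape WalkingCospan X.toFunctor := by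
  refine preservesPullbacks_of_lift _ (fun u x y h => ?_) (fun {e f g} s t x y h => ?_)
  · apply Subtype.ext
    refine (X.act u.elt).inj (X.translate_mem u x) ?_
    rw [show X.translate u x = X.translate u y from h]
    exact X.translate_mem u y
  · have hx := X.translate_mem s x
    have hy := X.translate_mem t y
    change X.translate s x = X.translate t y at h
    rw [← h] at hy
    have hr : (X.translate s x).1 ∈ X.act (pullbackObj s t).elt (X.translate s x).1 :=
      (X.mem_act_mul _ _ _ _).2 ⟨_, X.mem_act_ran hy, X.mem_act_ran hx⟩
    refine ⟨⟨_, _, hr⟩, (translate_eq_iff _ _ _).2 ?_, (translate_eq_iff _ _ _).2 ?_⟩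
    · exact (X.mem_act_mul_idem hr).2 ((X.mem_act_inv _ _ _).2 hx)
    · exact (X.mem_act_mul_idem hr).2 ((X.mem_act_inv _ _ _).2 hy)

/-- If `s x = y`, then the element `x` over `d(f s e)` lies over both `x ∈ Φ(X)(e)` and
`y ∈ Φ(X)(f)`, through the inclusion and `f s e` respectively. -/
theorem isDirectedFunctor_toFunctor (hX : isTransitive S X) :
    isDirectedFunctor (Loganathan S) X.toFunctor := by
  obtain ⟨⟨x⟩, hX⟩ := hX
  obtain ⟨s, y, hy⟩ := X.effective x
  refine ⟨⟨⟨domObj s, x, x, X.mem_act_dom hy⟩⟩, ?_⟩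
  rintro ⟨e, x⟩ ⟨f, y⟩
  obtain ⟨s, hs⟩ := hX x.1 y.1
  have h : y.1 ∈ X.act (f.elt * (s * e.elt)) x.1 :=
    (X.mem_act_mul _ _ _ _).2 ⟨_, (X.mem_act_mul_idem (x.mem_act e.idem)).2 hs, y.mem_act f.idem⟩
  have hle : NatLE (dom (f.elt * (s * e.elt))) e.elt := by
    rw [natLE_idem_iff (dom_idem _) e.idem, idem_comm e.idem (dom_idem _)]
    simp only [dom, mul_assoc, e.idem.eq]
  refine ⟨⟨domObj (f.elt * (s * e.elt)), x.1, _, X.mem_act_dom h⟩, ⟨⟨incl hle, ?_⟩⟩,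
    ⟨⟨homMk (f.elt * (s * e.elt)) rfl ?_, ?_⟩⟩⟩
  · exact Subtype.ext (translate_incl_val _ _)
  · rw [← mul_assoc, f.idem.eq]
  · exact (translate_eq_iff _ _ _).2 h

variable {X} in
/-- A bijection that preserves and reflects the action is an isomorphism of `S`-sets. -/
def isoMk {Y : LeftSet S} (φ : X.carrier ≃ Y.carrier)
    (h : ∀ s x y, y ∈ X.act s x ↔ φ y ∈ Y.act s (φ x)) : X ≅ Y where
  hom := (⟨φ, fun s x y => (h s x y).1⟩ : Hom X Y)
  inv := (⟨φ.symm, fun s x y hy => (h _ _ _).2 (by simpa using hy)⟩ : Hom Y X)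
  hom_inv_id := Hom.ext (funext φ.symm_apply_apply)
  inv_hom_id := Hom.ext (funext φ.apply_symm_apply)

variable (S) in
/-- The functor `Φ` on transitive `S`-sets, with values in pullback preserving directed
functors. -/
def PhiTransitive : (isTransitive S).FullSubcategory ⥤
    (isDirectedPullbackPreserving (Loganathan S)).FullSubcategory :=
  ObjectProperty.lift _ ((isTransitive S).ι ⋙ Phi S) fun X =>
    ⟨isDirectedFunctor_toFunctor X.obj X.property, preservesPullbacks_toFunctor X.obj⟩

end LeftSet

/-! ### Transitive `S`-sets and directed pullback preserving functors -/

namespace PsiConstruction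

open Loganathan LeftSet

variable {S : Type u} [InverseSemigroup S]

section

variable (X : LeftSet S)

/-- The map `Ψ(Φ(X)) → X` sending `[e, x]` to `x`. -/
def evalCarrier : Carrier X.toFunctor → X.carrier :=
  Quot.lift (fun p => p.2.1) (by
    rintro _ _ ⟨h, x⟩
    exact (translate_incl_val h x).symm)

theorem evalCarrier_bijective : Function.Bijective (evalCarrier X) := by
  constructor
  · intro α β h
    obtain ⟨e, x, rfl⟩ := mk_surjective _ α
    obtain ⟨f, y, rfl⟩ := mk_surjective _ β
    replace h : x.1 = y.1 := h
    have hy := y.mem_act f.idem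
    rw [← h] at hy
    refine (mk_eq_mk_iff _ _ _).2 ⟨meet e f, meet_le_left _ _, meet_le_right _ _,
      ⟨x.1, x.1, (X.mem_act_mul _ _ _ _).2 ⟨_, hy, x.mem_act e.idem⟩⟩, ?_, ?_⟩
    · exact Subtype.ext (translate_incl_val _ _)
    · exact Subtype.ext ((translate_incl_val _ _).trans h)
  · intro x
    obtain ⟨s, y, hy⟩ := X.effective x
    exact ⟨mk X.toFunctor (domObj s) ⟨x, x, X.mem_act_dom hy⟩, rfl⟩

theorem evalCarrier_mem_act_iff (s : S) (α β : Carrier X.toFunctor) :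
    β ∈ (toLeftSet X.toFunctor).act s α ↔ evalCarrier X β ∈ X.act s (evalCarrier X α) := by
  rw [mem_toLeftSet_act]
  constructor
  · rintro ⟨x, rfl, rfl⟩
    exact X.translate_mem (arrow s) x
  · intro h
    refine ⟨⟨evalCarrier X α, _, X.mem_act_dom h⟩, ?_, ?_⟩
    · exact (evalCarrier_bijective X).1 rfl
    · exact (evalCarrier_bijective X).1 ((translate_val_eq_iff _ _ _).2 h).symm

/-- The isomorphism `Ψ(Φ(X)) ≅ X`. -/
noncomputable def evalIso : toLeftSet X.toFunctor ≅ X :=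
  LeftSet.isoMk (Equiv.ofBijective _ (evalCarrier_bijective X)) (evalCarrier_mem_act_iff X)

end

section

variable (F : Loganathan S ⥤ Type u) [PreservesLimitsOfShape WalkingCospan F]

theorem mk_mem_act (e : Loganathan S) (x : F.obj e) :
    mk F e x ∈ (toLeftSet F).act e.elt (mk F e x) := by
  have := mk_map_mem_act F (𝟙 e) x
  rwa [F.map_id] at this

/-- The map `F(e) → Φ(Ψ(F))(e)` sending `x` to `[e, x]`. -/
def coevalApp (e : Loganathan S) (x : F.obj e) : (toLeftSet F).Dom e.elt :=
  ⟨mk F e x, _, mk_mem_act F e x⟩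

theorem coevalApp_bijective (e : Loganathan S) : Function.Bijective (coevalApp F e) := by
  refine ⟨fun x y h => mk_injective F e (congrArg Subtype.val h), fun α => ?_⟩
  obtain ⟨x, hx, -⟩ := (mem_toLeftSet_act F _ _ _).1 (α.mem_act e.idem)
  have he : domObj e.elt = e := by
    obtain ⟨e, h⟩ := e
    simp only [domObj, dom_of_idem h]
  have key : ∀ (f : Loganathan S) (y : F.obj f), f = e → α.1 = mk F f y →
      ∃ z, coevalApp F e z = α := by
    rintro f y rfl hx
    exact ⟨y, Subtype.ext hx.symm⟩
  exact key _ x he hx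

/-- The isomorphism `F ≅ Φ(Ψ(F))`. -/
noncomputable def coevalIso : F ≅ (toLeftSet F).toFunctor :=
  NatIso.ofComponents (fun e => (Equiv.ofBijective _ (coevalApp_bijective F e)).toIso) (by
    intro e f u
    ext x
    exact ((translate_eq_iff (X := toLeftSet F) u (coevalApp F e x)
      (coevalApp F f (F.map u x))).2 (mk_map_mem_act F u x)).symm)

end

variable (S) in
/-- The equivalence between transitive `S`-sets and pullback preserving directed functors given by
`Φ` and `Ψ`. -/
noncomputable def phiPsiEquivalence : (isTransitive S).FullSubcategory ≌
    (isDirectedPullbackPreserving (Loganathan S)).FullSubcategory :=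
  CategoryTheory.Equivalence.mk (PhiTransitive S) (Psi S)
    (NatIso.ofComponents (F := PhiTransitive S ⋙ Psi S) (G := 𝟭 _)
      (fun X => ObjectProperty.isoMk _ (evalIso X.obj)) (by
        intro X Y f
        apply ObjectProperty.hom_ext
        apply LeftSet.Hom.ext
        funext α
        obtain ⟨e, x, rfl⟩ := mk_surjective _ α
        rfl)).symm
    (NatIso.ofComponents (F := 𝟭 _) (G := Psi S ⋙ PhiTransitive S)
      (fun A => ObjectProperty.isoMk _ (coevalIso A.obj)) (by
        intro A B a
        apply ObjectProperty.hom_ext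
        ext e x
        rfl)).symm

theorem isPsi_Psi : IsPsi (Psi S ⋙ (isTransitive S).ι) :=
  ⟨fun _ => Equiv.refl _, fun F s α β => mem_toLeftSet_act F.obj s α β, fun _ _ _ _ _ => rfl⟩

end PsiConstruction

/-! ### Points of a presheaf topos -/

section

variable {C : Type u} [SmallCategory C]

/-- A filtered functor `C ⥤ Type u`, as a point of `C` for the trivial Grothendieck topology. -/
noncomputable def filteredPoint (A : C ⥤ Type u) [IsCofiltered A.Elements] :
    GrothendieckTopology.Point.{u} (⊥ : GrothendieckTopology C) where
  fiber := A
  initiallySmall := initiallySmall_of_essentiallySmall _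
  jointly_surjective {U} R hR x := by
    obtain rfl : R = ⊤ := by simpa using hR
    exact ⟨U, 𝟙 _, by simp, x, by simp⟩

theorem preservesFiniteLimits_of_isCofiltered_elements (A : C ⥤ Type u)
    [IsCofiltered A.Elements] :
    PreservesFiniteLimits A :=
  inferInstanceAs (PreservesFiniteLimits (filteredPoint A).fiber)

/-- The tensor product with a filtered functor is the inverse image of a point of the topos of
presheaves. -/
noncomputable def ToposPoint.ofFiltered (A : C ⥤ Type u) [IsCofiltered A.Elements] :
    ToposPoint.{u} (Cᵒᵖ ⥤ Type u) where
  inverseImage := (filteredPoint A).presheafFiber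
  directImage := Presheaf.restrictedULiftYoneda.{u} (uliftYoneda.{u} ⋙ _)
  adj := Presheaf.uliftYonedaAdjunction.{u} _ (𝟙 _)
  leftExact := inferInstance

/-- The inverse image of the point given by `A` restricts to `A` on representables. -/
noncomputable def ToposPoint.ofFilteredIso (A : C ⥤ Type u) [IsCofiltered A.Elements] :
    uliftYoneda.{u} ⋙ (ToposPoint.ofFiltered A).inverseImage ≅ A :=
  Functor.isoWhiskerRight uliftYonedaIsoShrinkYoneda.{u} _ ≪≫
    (filteredPoint A).shrinkYonedaCompPresheafFiberIso

/-- An inverse image functor `L` is left exact, so its category of elements is cofiltered. Since `L`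
preserves the presentation of a presheaf as a colimit of representables, every object of this
category receives an arrow from the full subcategory of elements over representables, which is
therefore cofiltered too. -/
theorem ToposPoint.isFilteredFunctor_restriction (p : ToposPoint.{u} (Cᵒᵖ ⥤ Type u)) :
    isFilteredFunctor C (uliftYoneda.{u} ⋙ p.inverseImage) := by
  have := p.leftExact
  have : PreservesColimitsOfSize.{u, u} p.inverseImage := p.adj.leftAdjoint_preservesColimits
  have : IsCofiltered p.inverseImage.Elements := Functor.isCofiltered_elements _
  let F : (uliftYoneda.{u} ⋙ p.inverseImage).Elements ⥤ p.inverseImage.Elements :=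
    { obj x := ⟨uliftYoneda.{u}.obj x.1, x.2⟩
      map f := ⟨uliftYoneda.{u}.map f.1, f.2⟩ }
  have hF : F.FullyFaithful :=
    { preimage := fun {x y} f => ⟨uliftYoneda.{u}.preimage f.1, by
        have := f.2
        dsimp [F] at this ⊢
        rwa [Functor.map_preimage]⟩
      map_preimage f := by apply Subtype.ext; simp [F]
      preimage_map f := by apply Subtype.ext; simp [F] }
  have := hF.full
  have := hF.faithful
  refine IsCofiltered.of_exists_of_isCofiltered_of_fullyFaithful F ?_
  rintro ⟨P, x⟩
  obtain ⟨c, y, hy⟩ := Types.jointly_surjective_of_isColimit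
    (isColimitOfPreserves p.inverseImage (Presheaf.colimitOfRepresentable.{u} P)) x
  exact ⟨⟨c.unop.1.unop, y⟩, ⟨(Presheaf.coconeOfRepresentable P).ι.app c, hy⟩⟩

/-- Restriction of the inverse image of a point of the topos of presheaves to representables. -/
noncomputable def ToposPoint.restriction (C : Type u) [SmallCategory C] :
    ToposPoint.{u} (Cᵒᵖ ⥤ Type u) ⥤ (isFilteredFunctor C).FullSubcategory :=
  (isFilteredFunctor C).lift
    (inducedFunctor GeometricMorphism.inverseImage ⋙
      (Functor.whiskeringLeft _ _ _).obj uliftYoneda.{u}) ToposPoint.isFilteredFunctor_restriction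

instance : (ToposPoint.restriction C).EssSurj where
  mem_essImage A :=
    have : IsCofiltered A.obj.Elements := A.2
    ⟨ToposPoint.ofFiltered A.obj,
      ⟨ObjectProperty.isoMk _ (ToposPoint.ofFilteredIso A.obj)⟩⟩

/-- Inverse images preserve colimits, so they are left Kan extensions along the Yoneda embedding and
their natural transformations are determined on representables. -/
theorem ToposPoint.whiskerLeft_bijective (p q : ToposPoint.{u} (Cᵒᵖ ⥤ Type u)) :
    Function.Bijective (fun a : p.inverseImage ⟶ q.inverseImage =>
      Functor.whiskerLeft uliftYoneda.{u} a) := by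
  have : PreservesColimitsOfSize.{u, u} p.inverseImage := p.adj.leftAdjoint_preservesColimits
  have : p.inverseImage.IsLeftKanExtension (𝟙 (uliftYoneda.{u} ⋙ p.inverseImage)) :=
    Presheaf.isLeftKanExtension_of_preservesColimits.{u} _ (Iso.refl _)
  convert (p.inverseImage.homEquivOfIsLeftKanExtension
    (𝟙 (uliftYoneda.{u} ⋙ p.inverseImage)) q.inverseImage).bijective using 1
  ext a
  simp [Functor.homEquivOfIsLeftKanExtension]

instance : (ToposPoint.restriction C).Faithful where
  map_injective {p q} _ _ h :=
    InducedCategory.hom_ext ((p.whiskerLeft_bijective q).1 (congrArg (fun k => k.hom) h))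

instance : (ToposPoint.restriction C).Full where
  map_surjective {p q} f := by
    obtain ⟨a, ha⟩ := (p.whiskerLeft_bijective q).2 f.hom
    exact ⟨⟨a⟩, ObjectProperty.hom_ext _ ha⟩

instance : (ToposPoint.restriction C).IsEquivalence where

end

/-! ### Torsors and filtered functors -/

namespace LeftSet

open Loganathan

variable {S : Type u} [InverseSemigroup S] {X : LeftSet S}

theorem isFilteredFunctor_toFunctor (hX : isTorsor S X) :
    isFilteredFunctor (Loganathan S) X.toFunctor := by
  obtain ⟨hne, hdir⟩ := X.isDirectedFunctor_toFunctor hX.1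
  refine { nonempty := hne, cone_objs := fun i j => ?_, cone_maps := ?_ }
  · obtain ⟨k, ⟨a⟩, ⟨b⟩⟩ := hdir i j
    exact ⟨k, a, b, trivial⟩
  · rintro ⟨e, x⟩ ⟨f, y⟩ ⟨(a : e ⟶ f), (ha : X.translate a x = y)⟩
      ⟨(b : e ⟶ f), (hb : X.translate b x = y)⟩
    obtain ⟨c, hca, hcb, hc⟩ := hX.2 _ _ _ _ ((translate_eq_iff _ _ _).1 ha)
      ((translate_eq_iff _ _ _).1 hb)
    have hle : NatLE (dom c) e.elt := by
      rw [← a.dom_eq]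
      exact hca.dom_le
    refine ⟨⟨domObj c, x.1, _, X.mem_act_dom hc⟩,
      ⟨incl hle, Subtype.ext (translate_incl_val _ _)⟩, Subtype.ext (hom_ext ?_)⟩
    change a.elt * dom c = b.elt * dom c
    rw [← hca.eq_mul_dom, ← hcb.eq_mul_dom]

/-- If `s x = t x`, cut `s` and `t` down to parallel arrows `u` and `v` of `L(S)` acting on `x`. An
arrow `h` that equalizes them and has `x` in its image gives the common lower bound
`u h h⁻¹ = v h h⁻¹` of `s` and `t`. -/
theorem isFree_of_isFilteredFunctor (hX : isFilteredFunctor (Loganathan S) X.toFunctor) :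
    isFree S X := by
  have : IsCofiltered X.toFunctor.Elements := hX
  intro s t x y hs ht
  let f : Loganathan S := meet (ranObj s) (ranObj t)
  let e : Loganathan S := meet (domObj (f.elt * s)) (domObj (f.elt * t))
  have hy : y ∈ X.act f.elt y := (X.mem_act_mul _ _ _ _).2 ⟨y, X.mem_act_ran ht, X.mem_act_ran hs⟩
  have hs' : y ∈ X.act (f.elt * s) x := (X.mem_act_mul _ _ _ _).2 ⟨y, hs, hy⟩
  have ht' : y ∈ X.act (f.elt * t) x := (X.mem_act_mul _ _ _ _).2 ⟨y, ht, hy⟩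
  have hx : x ∈ X.act e.elt x :=
    (X.mem_act_mul _ _ _ _).2 ⟨x, X.mem_act_dom ht', X.mem_act_dom hs'⟩
  let a : e ⟶ f := homMk (f.elt * s * e.elt) (dom_mul_idem e.idem (meet_le_left _ _))
    (by rw [← mul_assoc, ← mul_assoc, f.idem.eq])
  let b : e ⟶ f := homMk (f.elt * t * e.elt) (dom_mul_idem e.idem (meet_le_right _ _))
    (by rw [← mul_assoc, ← mul_assoc, f.idem.eq])
  let i : X.toFunctor.Elements := ⟨e, x, x, hx⟩
  let j : X.toFunctor.Elements := ⟨f, y, y, hy⟩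
  let a' : i ⟶ j := ⟨a, (translate_eq_iff _ _ _).2 ((X.mem_act_mul_idem hx).2 hs')⟩
  let b' : i ⟶ j := ⟨b, (translate_eq_iff _ _ _).2 ((X.mem_act_mul_idem hx).2 ht')⟩
  obtain ⟨⟨k, z⟩, ⟨(h : k ⟶ e), (hz : X.translate h z = _)⟩, hab⟩ :=
    IsCofilteredOrEmpty.cone_maps a' b'
  replace hab : f.elt * s * e.elt * h.elt = f.elt * t * e.elt * h.elt :=
    congrArg (fun m => m.1.elt) hab
  have hr : x ∈ X.act (ran h.elt) x := X.mem_act_ran ((translate_eq_iff _ _ _).1 hz)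
  have hle (w : S) : NatLE (f.elt * w * e.elt * ran h.elt) w :=
    (natLE_mul_idem _ (ran_idem _)).trans
      ((natLE_mul_idem _ e.idem).trans (natLE_idem_mul _ f.idem))
  refine ⟨f.elt * s * e.elt * ran h.elt, hle s, ?_, ?_⟩
  · rw [ran, ← mul_assoc, hab, mul_assoc (_ * _)]
    exact hle t
  · exact (X.mem_act_mul_idem hr).2 ((X.mem_act_mul_idem hx).2 hs')

/-! ### Torsors and universal `S`-sets -/

/-- The idempotents that fix the point `x`. -/
def stabilizerFilter (X : LeftSet S) (x : X.carrier) : IdempotentFilter S where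
  carrier := {e | IsIdempotentElem e ∧ x ∈ X.act e x}
  idem h := h.1
  nonempty := by
    obtain ⟨s, y, hy⟩ := X.effective x
    exact ⟨dom s, dom_idem s, X.mem_act_dom hy⟩
  mul_mem h h' := ⟨idem_mul h.1 h'.1, (X.mem_act_mul _ _ _ _).2 ⟨x, h'.2, h.2⟩⟩
  up_mem h hf hle := ⟨hf, X.mem_act_of_natLE hle h.2⟩

theorem mem_stabilizerFilter_up_iff (hX : isFree S X) (x : X.carrier) (s : S) :
    s ∈ (X.stabilizerFilter x).up.carrier ↔ x ∈ X.act s x := by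
  constructor
  · rintro ⟨e, he, hle⟩
    exact X.mem_act_of_natLE hle he.2
  · intro h
    obtain ⟨c, hcs, hcd, hc⟩ := hX _ _ _ _ h (X.mem_act_dom h)
    exact ⟨c, ⟨hcd.idem (dom_idem s), hc⟩, hcs⟩

/-- In a free `S`-set, the coset of `s` with respect to the stabilizer of `x` consists of all `t`
with `t x = s x`: a common lower bound `c` of `s` and `t` with `c x = s x` is of the form `s d(c)`,
where `d(c)` fixes `x`. -/
theorem cosetOf_stabilizerFilter (hX : isFree S X) {x y : X.carrier} {s : S} (h : y ∈ X.act s x) :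
    (X.stabilizerFilter x).up.cosetOf s = {t | y ∈ X.act t x} := by
  ext t
  constructor
  · rintro ⟨_, ⟨k, hk, rfl⟩, hle⟩
    exact X.mem_act_of_natLE hle
      ((X.mem_act_mul_idem ((mem_stabilizerFilter_up_iff hX x k).1 hk)).2 h)
  · intro ht
    obtain ⟨c, hcs, hct, hc⟩ := hX _ _ _ _ h ht
    refine ⟨_, ⟨dom c, (mem_stabilizerFilter_up_iff hX x _).2 (X.mem_act_dom hc), rfl⟩, ?_⟩
    dsimp only
    rwa [← hcs.eq_mul_dom]

section

variable (hX : isTorsor S X) (x : X.carrier)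

/-- The coset `{t | t x = y}` of a point `y` of a torsor with base point `x`. -/
def transporterCoset (y : X.carrier) :
    (X.stabilizerFilter x).up.Coset :=
  ⟨{t | y ∈ X.act t x}, by
    obtain ⟨s, hs⟩ := hX.1.2 x y
    exact ⟨s, (mem_stabilizerFilter_up_iff hX.2 x _).2 (X.mem_act_dom hs),
      (cosetOf_stabilizerFilter hX.2 hs).symm⟩⟩

theorem mem_cosetOf_self {H : ClosedInverseSubsemigroup S} {s : S} (hs : dom s ∈ H.carrier) :
    s ∈ H.cosetOf s := by
  have := H.mul_mem_cosetOf s hs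
  rwa [mul_dom] at this

theorem transporterCoset_bijective : Function.Bijective (transporterCoset hX x) := by
  constructor
  · intro y y' h
    obtain ⟨s, hs⟩ := hX.1.2 x y
    have hs' : s ∈ (transporterCoset hX x y).1 := hs
    rw [h] at hs'
    exact Option.mem_unique hs hs'
  · rintro ⟨A, s, hs, rfl⟩
    obtain ⟨y, hy, -⟩ :=
      (X.mem_act_mul _ _ _ _).1 ((mem_stabilizerFilter_up_iff hX.2 x _).1 hs)
    exact ⟨y, Subtype.ext (cosetOf_stabilizerFilter hX.2 hy).symm⟩

theorem transporterCoset_mem_act_iff (s : S) (y z : X.carrier) :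
    z ∈ X.act s y ↔ transporterCoset hX x z ∈
      (X.stabilizerFilter x).up.cosetSet.act s (transporterCoset hX x y) := by
  let H := (X.stabilizerFilter x).up
  refine Iff.trans ?_ (PEquiv.mem_ofGraph _ (H.cosetRel_functional s) (H.cosetRel_injective s)
    (transporterCoset hX x y) (transporterCoset hX x z)).symm
  constructor
  · intro h
    obtain ⟨t, ht⟩ := hX.1.2 x y
    exact ⟨t, (mem_stabilizerFilter_up_iff hX.2 x _).2 (X.mem_act_dom ht),
      (cosetOf_stabilizerFilter hX.2 ht).symm,
      (cosetOf_stabilizerFilter hX.2 ((X.mem_act_mul _ _ _ _).2 ⟨y, ht, h⟩)).symm⟩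
  · rintro ⟨t, ht, hy, hz⟩
    have hty : y ∈ X.act t x := by
      have : t ∈ (transporterCoset hX x y).1 := hy ▸ mem_cosetOf_self ht
      exact this
    have hstz : z ∈ X.act (s * t) x := by
      have : s * t ∈ (transporterCoset hX x z).1 := by
        have := H.mul_mem_cosetOf (s * t) ht
        rw [mul_assoc, mul_dom] at this
        exact hz ▸ this
      exact this
    obtain ⟨w, hw, hw'⟩ := (X.mem_act_mul _ _ _ _).1 hstz
    rwa [Option.mem_unique hty hw]

end

theorem isUniversal_of_isTorsor (hX : isTorsor S X) : isUniversal S X := by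
  obtain ⟨x⟩ := hX.1.1
  exact ⟨X.stabilizerFilter x, ⟨isoMk (Equiv.ofBijective _ (transporterCoset_bijective hX x))
    (transporterCoset_mem_act_iff hX x)⟩⟩

theorem isTorsor_of_iso {Y : LeftSet S} (i : X ≅ Y) (hY : isTorsor S Y) : isTorsor S X := by
  have hinv (x : X.carrier) : i.inv.toFun (i.hom.toFun x) = x :=
    congrFun (congrArg Hom.toFun i.hom_inv_id) x
  have hiff (s : S) (x y : X.carrier) :
      y ∈ X.act s x ↔ i.hom.toFun y ∈ Y.act s (i.hom.toFun x) := by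
    refine ⟨i.hom.map_act s x y, fun h => ?_⟩
    have := i.inv.map_act s _ _ h
    rwa [hinv, hinv] at this
  obtain ⟨⟨⟨y⟩, htrans⟩, hfree⟩ := hY
  refine ⟨⟨⟨i.inv.toFun y⟩, fun x x' => ?_⟩, fun s t x x' hs ht => ?_⟩
  · obtain ⟨s, hs⟩ := htrans (i.hom.toFun x) (i.hom.toFun x')
    exact ⟨s, (hiff _ _ _).2 hs⟩
  · obtain ⟨c, hcs, hct, hc⟩ := hfree s t _ _ ((hiff _ _ _).1 hs) ((hiff _ _ _).1 ht)
    exact ⟨c, hcs, hct, (hiff _ _ _).2 hc⟩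

/-- Cosets with respect to `F↑` form a torsor. If `s` and `t` agree on `(xF↑)↑`, then `t x e ≤ s x`
for some `e ∈ F`, and `t x e x⁻¹` is a common lower bound of `s` and `t` with the same value. -/
theorem isTorsor_cosetSet (F : IdempotentFilter S) : isTorsor S F.up.cosetSet := by
  let H := F.up
  have mem_act (s : S) (A B : H.Coset) : B ∈ H.cosetSet.act s A ↔ H.cosetRel s A B :=
    PEquiv.mem_ofGraph _ (H.cosetRel_functional s) (H.cosetRel_injective s) A B
  have memH {e : S} (he : e ∈ F.carrier) : e ∈ H.carrier := ⟨e, he, NatLE.refl e⟩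
  refine ⟨⟨?_, ?_⟩, ?_⟩
  · obtain ⟨e, he⟩ := F.nonempty
    exact ⟨⟨H.cosetOf e, e, by rw [dom_of_idem (F.idem he)]; exact memH he, rfl⟩⟩
  · rintro ⟨A, x, hx, rfl⟩ ⟨B, y, hy, rfl⟩
    refine ⟨y * x⁻¹, (mem_act _ _ _).2 ⟨x, hx, rfl, ?_⟩⟩
    rw [mul_assoc]
    exact (H.cosetOf_mul_idem y (dom_idem x) hx).symm
  · intro s t A B hs ht
    obtain ⟨x, hx, hA, hB⟩ := (mem_act _ _ _).1 hs
    obtain ⟨x', hx', hA', hB'⟩ := (mem_act _ _ _).1 ht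
    have hst : H.cosetOf (s * x) = H.cosetOf (t * x) :=
      hB.symm.trans (hB'.trans (H.cosetOf_mul_congr (hA'.symm.trans hA) t))
    have hmem : s * x ∈ H.cosetOf (t * x) := by
      rw [← hst]
      have := H.mul_mem_cosetOf (s * x) hx
      rwa [mul_assoc, mul_dom] at this
    obtain ⟨_, ⟨k, ⟨e, he, hek⟩, rfl⟩, hle⟩ := hmem
    have he' := F.idem he
    have hidem : IsIdempotentElem (x * e * x⁻¹) := by
      simpa only [inv_inv'] using conj_idem he' x⁻¹
    refine ⟨t * (x * e * x⁻¹), ?_, natLE_mul_idem _ hidem, (mem_act _ _ _).2 ⟨x, hx, hA, ?_⟩⟩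
    · have h1 : NatLE (t * x * e) (s * x) := ((NatLE.refl (t * x)).mul hek).trans hle
      have h2 : NatLE (t * x * e * x⁻¹) (s * x * x⁻¹) := h1.mul (NatLE.refl _)
      rw [mul_assoc s] at h2
      simp only [mul_assoc] at h2 ⊢
      exact h2.trans (natLE_mul_idem s (ran_idem x))
    · have : t * (x * e * x⁻¹) * x = t * x * (e * dom x) := by simp only [dom, mul_assoc]
      rw [this, H.cosetOf_mul_idem _ (idem_mul he' (dom_idem x)) (H.mul_mem (memH he) hx)]
      exact hB.trans hst

theorem isUniversal_iff_isTorsor (X : LeftSet S) : isUniversal S X ↔ isTorsor S X :=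
  ⟨fun ⟨F, ⟨i⟩⟩ => isTorsor_of_iso i (isTorsor_cosetSet F), isUniversal_of_isTorsor⟩

theorem isUniversal_iff_isFilteredFunctor (hX : isTransitive S X) :
    isUniversal S X ↔ isFilteredFunctor (Loganathan S) X.toFunctor := by
  rw [isUniversal_iff_isTorsor]
  exact ⟨isFilteredFunctor_toFunctor, fun h => ⟨hX, isFree_of_isFilteredFunctor h⟩⟩

end LeftSet

/-! ### Restriction of the equivalence -/

theorem isFilteredFunctor_of_iso {C : Type u} [SmallCategory C] {A B : C ⥤ Type u} (i : A ≅ B)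
    (hA : isFilteredFunctor C A) : isFilteredFunctor C B := by
  have : IsCofiltered A.Elements := hA
  exact IsCofiltered.of_equivalence (CategoryTheory.Equivalence.mk
    (CategoryOfElements.map i.hom) (CategoryOfElements.map i.inv)
    (NatIso.ofComponents (fun x => CategoryOfElements.isoMk _ _ (Iso.refl _)
        ((ConcreteCategory.congr_hom (A.map_id x.1) x.2).trans
          (ConcreteCategory.congr_hom (i.hom_inv_id_app x.1) x.2).symm))
        fun f => Subtype.ext ((Category.comp_id _).trans (Category.id_comp _).symm))
    (NatIso.ofComponents (fun x => CategoryOfElements.isoMk _ _ (Iso.refl _)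
        ((ConcreteCategory.congr_hom (B.map_id x.1) _).trans
          (ConcreteCategory.congr_hom (i.inv_hom_id_app x.1) x.2)))
        fun f => Subtype.ext ((Category.comp_id _).trans (Category.id_comp _).symm)))

theorem isFilteredFunctor_le_isDirectedPullbackPreserving (C : Type u) [SmallCategory C] :
    isFilteredFunctor C ≤ isDirectedPullbackPreserving C := by
  intro A hA
  have : IsCofiltered A.Elements := hA
  have := preservesFiniteLimits_of_isCofiltered_elements A
  exact ⟨⟨IsCofiltered.nonempty, fun i j =>
    ⟨IsCofiltered.min i j, ⟨IsCofiltered.minToLeft i j⟩, ⟨IsCofiltered.minToRight i j⟩⟩⟩,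
    inferInstance⟩

/-- An equivalence between full subcategories restricts to smaller full subcategories that are
carried into each other by its two functors. -/
def CategoryTheory.Equivalence.restrictFullSubcategory {C : Type u₁} [Category.{v₁} C] {D : Type u₂}
    [Category.{v₂} D] {P P' : ObjectProperty C} {Q Q' : ObjectProperty D}
    (E : P.FullSubcategory ≌ Q.FullSubcategory) (hP : P' ≤ P) (hQ : Q' ≤ Q)
    (h : ∀ X : P.FullSubcategory, P' X.obj → Q' (E.functor.obj X).obj)
    (h' : ∀ Y : Q.FullSubcategory, Q' Y.obj → P' (E.inverse.obj Y).obj) :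
    P'.FullSubcategory ≌ Q'.FullSubcategory :=
  CategoryTheory.Equivalence.mk
    (Q'.lift (ObjectProperty.ιOfLE hP ⋙ E.functor ⋙ Q.ι) fun X => h _ X.property)
    (P'.lift (ObjectProperty.ιOfLE hQ ⋙ E.inverse ⋙ P.ι) fun Y => h' _ Y.property)
    (NatIso.ofComponents
      (fun X => P'.isoMk (P.ι.mapIso (E.unitIso.app ((ObjectProperty.ιOfLE hP).obj X)))) fun f => by
        apply ObjectProperty.hom_ext
        exact congrArg (fun k => k.hom)
          (E.unitIso.hom.naturality ((ObjectProperty.ιOfLE hP).map f)))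
    (NatIso.ofComponents
      (fun Y => Q'.isoMk (Q.ι.mapIso (E.counitIso.app ((ObjectProperty.ιOfLE hQ).obj Y))))
      fun f => by
        apply ObjectProperty.hom_ext
        exact congrArg (fun k => k.hom)
          (E.counitIso.hom.naturality ((ObjectProperty.ιOfLE hQ).map f)))

theorem proposition3 (S : Type u) [InverseSemigroup S] :
    (∃ E : (LeftSet.isTransitive S).FullSubcategory ≌
        (isDirectedPullbackPreserving (Loganathan S)).FullSubcategory,
      Nonempty (E.functor ⋙ (isDirectedPullbackPreserving (Loganathan S)).ι ≅
        (LeftSet.isTransitive S).ι ⋙ LeftSet.Phi S) ∧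
      PsiConstruction.IsPsi (E.inverse ⋙ (LeftSet.isTransitive S).ι) ∧
      ∃ (hU : LeftSet.isUniversal S ≤ LeftSet.isTransitive S)
        (hF : isFilteredFunctor (Loganathan S) ≤ isDirectedPullbackPreserving (Loganathan S)),
        (∀ X : (LeftSet.isTransitive S).FullSubcategory,
          LeftSet.isUniversal S X.obj ↔
            isFilteredFunctor (Loganathan S) (E.functor.obj X).obj) ∧
        (∀ A : (isDirectedPullbackPreserving (Loganathan S)).FullSubcategory,
          isFilteredFunctor (Loganathan S) A.obj ↔
            LeftSet.isUniversal S (E.inverse.obj A).obj) ∧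
        ∃ E' : (LeftSet.isUniversal S).FullSubcategory ≌
            (isFilteredFunctor (Loganathan S)).FullSubcategory,
          Nonempty (E'.functor ⋙ ObjectProperty.ιOfLE hF ≅
            ObjectProperty.ιOfLE hU ⋙ E.functor) ∧
          Nonempty (E'.inverse ⋙ ObjectProperty.ιOfLE hU ≅
            ObjectProperty.ιOfLE hF ⋙ E.inverse)) ∧
    (∀ X : LeftSet S, LeftSet.isUniversal S X ↔ LeftSet.isTorsor S X) ∧
    Nonempty (ToposPoint.{u} (ClassifyingTopos S) ≌ (LeftSet.isUniversal S).FullSubcategory) := by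
  have hU : LeftSet.isUniversal S ≤ LeftSet.isTransitive S :=
    fun X hX => ((LeftSet.isUniversal_iff_isTorsor X).1 hX).1
  have hF := isFilteredFunctor_le_isDirectedPullbackPreserving (Loganathan S)
  have hPhi (X : (LeftSet.isTransitive S).FullSubcategory) : LeftSet.isUniversal S X.obj ↔
      isFilteredFunctor (Loganathan S) ((PsiConstruction.phiPsiEquivalence S).functor.obj X).obj :=
    LeftSet.isUniversal_iff_isFilteredFunctor X.property
  have hPsi (A : (isDirectedPullbackPreserving (Loganathan S)).FullSubcategory) :
      isFilteredFunctor (Loganathan S) A.obj ↔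
        LeftSet.isUniversal S ((PsiConstruction.phiPsiEquivalence S).inverse.obj A).obj :=
    Iff.trans ⟨isFilteredFunctor_of_iso (PsiConstruction.coevalIso A.obj),
      isFilteredFunctor_of_iso (PsiConstruction.coevalIso A.obj).symm⟩ 
      (hPhi ((PsiConstruction.Psi S).obj A)).symm
  let E' := (PsiConstruction.phiPsiEquivalence S).restrictFullSubcategory hU hF
    (fun X => (hPhi X).1) (fun A => (hPsi A).1)
  exact ⟨⟨PsiConstruction.phiPsiEquivalence S, ⟨Iso.refl _⟩, PsiConstruction.isPsi_Psi, hU, hF,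
    hPhi, hPsi, E', ⟨Iso.refl _⟩, ⟨Iso.refl _⟩⟩, LeftSet.isUniversal_iff_isTorsor,
    ⟨(ToposPoint.restriction (Loganathan S)).asEquivalence.trans E'.symm⟩⟩
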